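/- Let $X$ be a Fano manifold, i.e. a compact connected complex manifold of dimension $n$ whose anticanonical line bundle $-K_X=\Lambda^n TX$ is ample. For $k\ge 1$ put $N_k=\dim H^0(X,-kK_X)$. Given a basis $s_1,\dots,s_{N_k}$ of $H^0(X,-kK_X)$ let $\det S^{(k)}(x_1,\dots,x_{N_k})=\det(s_i(x_j))$, a holomorphic section of $(-kK_X)^{\boxtimes N_k}$ over $X^{N_k}$ which, up to a non-zero multiplicative constant, does not depend on the basis, and let $$Z_{N_k}=\int_{X^{N_k}}\bigl|\det S^{(k)}(z_1,\dots,z_{N_k})\bigr|^{-2/k}\,dz_1\wedge d\bar z_1\wedge\cdots\wedge dz_{N_k}\wedge d\bar z_{N_k}\in(0,\infty],$$ where $dz\wedge d\bar z$ denotes the Euclidean volume form in local holomorphic coordinates $z$ on $X$ and $\det S^{(k)}$ is expressed in the corresponding local frames (the integrand is then a globally well-defined density). Let $\mathcal D_k$ be the divisor of $\det S^{(k)}$ on $X^{N_k}$, let $\mathrm{lct}(\mathcal D_k/k)\in[0,\infty]$ be the supremum of all $t\ge 0$ such that $|\det S^{(k)}|^{-2t/k}$ is locally integrable on $X^{N_k}$,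 and let $\gamma(X)=\liminf_{k\to\infty}\mathrm{lct}(\mathcal D_k/k)$. Call $X$ asymptotically Gibbs stable if $Z_{N_k}<\infty$ for all sufficiently large $k$. **Proposition.** Suppose that $X$ admits a holomorphic vector field that is not identically zero. Then $Z_{N_k}=\infty$ for all sufficiently large $k$. In particular $\gamma(X)\le 1$, and $X$ is not asymptotically Gibbs stable. -/

import Mathlib

open MeasureTheory Filter Topology
open scoped Manifold ContDiff ENNReal NNReal

noncomputable section

namespace Fano

/-- The holomorphic coordinate charts of an `n`-dimensional complex manifold `X`: all charts of the
maximal holomorphic atlas. -/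
abbrev HolChart (n : ℕ) (X : Type*) [TopologicalSpace X] [ChartedSpace (Fin n → ℂ) X] : Type _ :=
  {e : OpenPartialHomeomorph X (Fin n → ℂ) //
    e ∈ IsManifold.maximalAtlas 𝓘(ℂ, Fin n → ℂ) ω X}

section Sections

variable (n : ℕ) (X : Type*) [TopologicalSpace X] [ChartedSpace (Fin n → ℂ) X]

/-- The Jacobian determinant `det (∂w/∂z)` of the change of coordinates from the coordinates
`z = e x` to the coordinates `w = e' x`, as a function of `z`. -/
def jacobian {n : ℕ} {X : Type*} [TopologicalSpace X] [ChartedSpace (Fin n → ℂ) X]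
    (e e' : HolChart n X) (z : Fin n → ℂ) : ℂ :=
  (fderiv ℂ (fun z => e'.1 (e.1.symm z)) z).det

/-- The space `H⁰(X, -k K_X)` of global holomorphic sections of the `k`-th tensor power of the
anticanonical line bundle `-K_X = Λⁿ TX`.  A section is given by its coefficients
`s_e : e.target → ℂ` in the local frames `(∂/∂z₁ ∧ ⋯ ∧ ∂/∂zₙ)^{⊗ k}` of all holomorphic charts `e`;
they are holomorphic and satisfy `s_{e'} = det (∂w/∂z) ^ k * s_e` on overlaps.  (Outside `e.target`,
where it has no meaning, `s_e` is set to `0`.) -/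
def H0 (k : ℕ) : Submodule ℂ (HolChart n X → (Fin n → ℂ) → ℂ) where
  carrier := {s |
    (∀ e : HolChart n X, AnalyticOnNhd ℂ (s e) e.1.target) ∧
    (∀ e : HolChart n X, ∀ z, z ∉ e.1.target → s e z = 0) ∧
    (∀ e e' : HolChart n X, ∀ x, x ∈ e.1.source → x ∈ e'.1.source →
      s e' (e'.1 x) = jacobian e e' (e.1 x) ^ k * s e (e.1 x))}
  zero_mem' := by
    refine ⟨fun e => analyticOnNhd_const, fun e z _ => rfl, fun e e' x _ _ => ?_⟩
    simp
  add_mem' := by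
    rintro s t ⟨hs₁, hs₂, hs₃⟩ ⟨ht₁, ht₂, ht₃⟩
    refine ⟨fun e => (hs₁ e).add (ht₁ e), fun e z hz => ?_, fun e e' x hx hx' => ?_⟩
    · simp [hs₂ e z hz, ht₂ e z hz]
    · simp [hs₃ e e' x hx hx', ht₃ e e' x hx hx', mul_add]
  smul_mem' := by
    rintro c s ⟨hs₁, hs₂, hs₃⟩
    refine ⟨fun e => analyticOnNhd_const.mul (hs₁ e), fun e z hz => ?_, fun e e' x hx hx' => ?_⟩
    · simp [hs₂ e z hz]
    · simp [hs₃ e e' x hx hx', mul_left_comm]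

/-- `N_k = dim H⁰(X, -k K_X)`. -/
def Nk (k : ℕ) : ℕ := Module.finrank ℂ (H0 n X k)

/-- `-m K_X` is very ample: its global sections have no common zero, separate points and separate
tangent directions, i.e. they define an embedding of the compact manifold `X` into a projective
space. Whether a section vanishes at `x`, and whether its derivative at a zero `x` in a given
direction vanishes, may be read off in any holomorphic chart around `x`. -/
def VeryAmple (m : ℕ) : Prop :=
  (∀ x : X, ∃ s ∈ H0 n X m, ∀ e : HolChart n X, x ∈ e.1.source → s e (e.1 x) ≠ 0) ∧
  (∀ x y : X, x ≠ y → ∃ s ∈ H0 n X m,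
    (∀ e : HolChart n X, x ∈ e.1.source → s e (e.1 x) = 0) ∧
    (∀ e : HolChart n X, y ∈ e.1.source → s e (e.1 y) ≠ 0)) ∧
  (∀ x : X, ∀ e : HolChart n X, x ∈ e.1.source → ∀ u : Fin n → ℂ, u ≠ 0 →
    ∃ s ∈ H0 n X m, s e (e.1 x) = 0 ∧ fderiv ℂ (s e) (e.1 x) u ≠ 0)

/-- The anticanonical line bundle `-K_X` is ample: some positive tensor power is very ample. -/
def AnticanonicalAmple : Prop := ∃ m : ℕ, 0 < m ∧ VeryAmple n X m

end Sections

section Partition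

variable {n : ℕ} {X : Type*} [TopologicalSpace X] [ChartedSpace (Fin n → ℂ) X]

/-- The open set of `(ℂⁿ)^N` on which the product coordinates of charts `e₁, …, e_N` take values. -/
def prodTarget {N : ℕ} (e : Fin N → HolChart n X) : Set (Fin N → Fin n → ℂ) :=
  {z | ∀ j, z j ∈ (e j).1.target}

/-- The local expression `det (s_i (z_j))` of the section `det S^{(k)}` of `(-k K_X)^{⊠ N_k}` over
`X ^ N_k` defined by a basis `(s_i)` of `H⁰(X, -k K_X)`, in the product of charts `e₁, …, e_N`. -/
def detS {k : ℕ} (b : Module.Basis (Fin (Nk n X k)) ℂ (H0 n X k))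
    (e : Fin (Nk n X k) → HolChart n X) (z : Fin (Nk n X k) → Fin n → ℂ) : ℂ :=
  Matrix.det (Matrix.of fun i j => (b i).1 (e j) (z j))

/-- The local density `|det S^{(k)}|^{-2t/k}`; it is `+∞` on the zero locus of `det S^{(k)}`
(if `t, k > 0`). -/
def localDensity {k : ℕ} (b : Module.Basis (Fin (Nk n X k)) ℂ (H0 n X k)) (t : ℝ)
    (e : Fin (Nk n X k) → HolChart n X) (z : Fin (Nk n X k) → Fin n → ℂ) : ℝ≥0∞ :=
  ‖detS b e z‖ₑ ^ (-(2 * t / k) : ℝ)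

/-- The measure `|det S^{(k)}|^{-2/k} dz₁ ∧ dz̄₁ ∧ ⋯ ∧ dz_N ∧ dz̄_N` on the domain of the product of
the charts `e₁, …, e_N`, as a measure on `X ^ N_k`. -/
def localMeasure [MeasurableSpace X] {k : ℕ}
    (b : Module.Basis (Fin (Nk n X k)) ℂ (H0 n X k)) (e : Fin (Nk n X k) → HolChart n X) :
    Measure (Fin (Nk n X k) → X) :=
  ((volume.restrict (prodTarget e)).withDensity (localDensity b 1 e)).map
    (fun z j => (e j).1.symm (z j))

/-- The global measure `|det S^{(k)}|^{-2/k} dz₁ ∧ dz̄₁ ∧ ⋯ ∧ dz_N ∧ dz̄_N` on `X ^ N_k`.  The local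
measures agree on overlaps of charts, and the measure glued from them is their least upper bound in
the lattice of measures: it dominates each of them, and any measure that does so dominates it on
each piece of a measurable partition of `X ^ N_k` into subsets of chart domains. -/
def canonicalMeasure [MeasurableSpace X] {k : ℕ}
    (b : Module.Basis (Fin (Nk n X k)) ℂ (H0 n X k)) : Measure (Fin (Nk n X k) → X) :=
  ⨆ e : Fin (Nk n X k) → HolChart n X, localMeasure b e

/-- The canonical partition function `Z_{N_k} = ∫_{X^{N_k}} |det S^{(k)}|^{-2/k} dz ∧ dz̄`, for the
generator `det S^{(k)}` given by a basis of `H⁰(X, -k K_X)`. -/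
def partitionFunction [MeasurableSpace X] {k : ℕ}
    (b : Module.Basis (Fin (Nk n X k)) ℂ (H0 n X k)) : ℝ≥0∞ :=
  canonicalMeasure b Set.univ

/-- `|det S^{(k)}|^{-2t/k}` is locally integrable on `X ^ N_k`. -/
def LocIntegrable {k : ℕ} (b : Module.Basis (Fin (Nk n X k)) ℂ (H0 n X k)) (t : ℝ) : Prop :=
  ∀ e : Fin (Nk n X k) → HolChart n X, ∀ K ⊆ prodTarget e, IsCompact K →
    ∫⁻ z in K, localDensity b t e z < ⊤

end Partition

section Stability

variable (n : ℕ) (X : Type*) [TopologicalSpace X] [ChartedSpace (Fin n → ℂ) X]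

/-- `X` is Gibbs stable at level `k`: `Z_{N_k}` is finite (for any generator `det S^{(k)}`). -/
def GibbsStableAt [MeasurableSpace X] (k : ℕ) : Prop :=
  ∀ b : Module.Basis (Fin (Nk n X k)) ℂ (H0 n X k), partitionFunction b < ⊤

/-- `X` is asymptotically Gibbs stable: Gibbs stable at level `k` for all sufficiently large `k`. -/
def AsymptoticallyGibbsStable [MeasurableSpace X] : Prop :=
  ∀ᶠ k : ℕ in atTop, GibbsStableAt n X k

/-- The log canonical threshold `lct(𝒟_k / k)`, where `𝒟_k` is the divisor of `det S^{(k)}` on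
`X ^ N_k`: the supremum of all `t ≥ 0` such that `|det S^{(k)}|^{-2t/k}` is locally integrable (for
any generator `det S^{(k)}`). -/
def lct (k : ℕ) : ℝ≥0∞ :=
  ⨆ (t : ℝ≥0) (_ : ∀ b : Module.Basis (Fin (Nk n X k)) ℂ (H0 n X k), LocIntegrable b t), (t : ℝ≥0∞)

/-- `γ(X) = liminf_{k → ∞} lct(𝒟_k / k)`. -/
def gammaInv : ℝ≥0∞ := liminf (fun k : ℕ => lct n X k) atTop

end Stability

end Fano

end

/-! Suppose `Z` is finite at some level `k` with `N_k > 0`. A biholomorphism `φ` of `X` acts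
linearly on `H⁰(X, -kK_X)`, so acting diagonally on `X ^ N_k` it multiplies `det S` by a constant,
and hence the canonical measure by a constant. A finite non-zero total mass forces this constant to
be `1` (`measurePreserving_canonicalMeasure`). The marginal of the canonical measure on one factor
is then a finite measure on `X`, invariant under all biholomorphisms and positive on non-empty open
sets.

A non-zero holomorphic vector field `V` contradicts this. Take `m` with `-mK_X` very ample. The Lie
derivative along `V` on `H⁰(X, -mK_X)` is not a scalar, because sections separate tangent
directions; so it has two distinct eigenvalues or a Jordan block (`VField.exists_eigensections`).
The ratio `s / t` of the corresponding sections is multiplied by a character, or translated, under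
the flow of `V`. At a suitable time, `log |s / t|` or `Re (s / t)` increases by a non-zero constant
on an invariant dense open set, which Poincaré recurrence forbids for a finite invariant measure
(`measure_eq_zero_of_translation`).

The flow is built projectively: the transposed Lie derivative generates a linear flow on the dual
space of sections, and it preserves the embedded `X` because for each point the set of times at
which it stays in `X` is clopen (`VField.exists_projRel`). Positivity of `N_k` for large `k` comes
from a Wronskian, a section of `-(m(n+1)-1)K_X`, whose degree is prime to `m`.

For the threshold, integrability at an exponent `t ≥ 1` implies integrability at `1`, hence
finiteness of `Z` by compactness; so divergence gives `lct ≤ 1`. -/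

noncomputable section

namespace Fano

/-! ### Coordinate changes and their Jacobians. -/

section Charts

variable {n : ℕ} {X : Type*} [TopologicalSpace X] [ChartedSpace (Fin n → ℂ) X]

/-- The change of coordinates from the chart `e` to the chart `e'`. -/
def transition (e e' : HolChart n X) (z : Fin n → ℂ) : Fin n → ℂ := e'.1 (e.1.symm z)

/-- The domain of the change of coordinates from `e` to `e'`. -/
def overlap (e e' : HolChart n X) : Set (Fin n → ℂ) := (e.1.symm.trans e'.1).source

lemma mem_overlap {e e' : HolChart n X} {z : Fin n → ℂ} :
    z ∈ overlap e e' ↔ z ∈ e.1.target ∧ e.1.symm z ∈ e'.1.source := by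
  simp [overlap]

lemma isOpen_overlap (e e' : HolChart n X) : IsOpen (overlap e e') :=
  (e.1.symm.trans e'.1).open_source

lemma overlap_apply_mem {e e' : HolChart n X} {x : X} (hx : x ∈ e.1.source)
    (hx' : x ∈ e'.1.source) : e.1 x ∈ overlap e e' := by
  rw [mem_overlap, e.1.left_inv hx]
  exact ⟨e.1.map_source hx, hx'⟩

lemma overlap_mem_nhds {e e' : HolChart n X} {x : X} (hx : x ∈ e.1.source)
    (hx' : x ∈ e'.1.source) : overlap e e' ∈ 𝓝 (e.1 x) :=
  (isOpen_overlap e e').mem_nhds (overlap_apply_mem hx hx')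

lemma transition_apply {e : HolChart n X} (e' : HolChart n X) {x : X} (hx : x ∈ e.1.source) :
    transition e e' (e.1 x) = e'.1 x := by
  rw [transition, e.1.left_inv hx]

lemma analyticOnNhd_transition (e e' : HolChart n X) :
    AnalyticOnNhd ℂ (transition e e') (overlap e e') := by
  have h := contMDiffOn_of_mem_contDiffGroupoid
    (IsManifold.compatible_of_mem_maximalAtlas e.2 e'.2)
  rw [contMDiffOn_iff_contDiffOn, contDiffOn_omega_iff_analyticOn
    (e.1.symm.trans e'.1).open_source.uniqueDiffOn] at h
  exact ((e.1.symm.trans e'.1).open_source.analyticOn_iff_analyticOnNhd).1 h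

lemma analyticAt_transition {e e' : HolChart n X} {x : X} (hx : x ∈ e.1.source)
    (hx' : x ∈ e'.1.source) : AnalyticAt ℂ (transition e e') (e.1 x) :=
  analyticOnNhd_transition e e' _ (overlap_apply_mem hx hx')

lemma differentiableAt_transition {e e' : HolChart n X} {x : X} (hx : x ∈ e.1.source)
    (hx' : x ∈ e'.1.source) : DifferentiableAt ℂ (transition e e') (e.1 x) :=
  (analyticAt_transition hx hx').differentiableAt

lemma transition_comp_eventuallyEq {e e' : HolChart n X} (e'' : HolChart n X) {x : X}
    (hx : x ∈ e.1.source) (hx' : x ∈ e'.1.source) :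
    transition e e'' =ᶠ[𝓝 (e.1 x)] transition e' e'' ∘ transition e e' := by
  filter_upwards [overlap_mem_nhds hx hx'] with z hz
  rw [mem_overlap] at hz
  simp only [transition, Function.comp]
  rw [e'.1.left_inv hz.2]

lemma fderiv_transition_comp {e e' e'' : HolChart n X} {x : X} (hx : x ∈ e.1.source)
    (hx' : x ∈ e'.1.source) (hx'' : x ∈ e''.1.source) :
    fderiv ℂ (transition e e'') (e.1 x) =
      (fderiv ℂ (transition e' e'') (e'.1 x)).comp (fderiv ℂ (transition e e') (e.1 x)) := by
  rw [(transition_comp_eventuallyEq e'' hx hx').fderiv_eq, fderiv_comp,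
    transition_apply e' hx]
  · rw [transition_apply e' hx]; exact differentiableAt_transition hx' hx''
  · exact differentiableAt_transition hx hx'

lemma fderiv_transition_self {e : HolChart n X} {x : X} (hx : x ∈ e.1.source) :
    fderiv ℂ (transition e e) (e.1 x) = ContinuousLinearMap.id ℂ _ := by
  have : transition e e =ᶠ[𝓝 (e.1 x)] id := by
    filter_upwards [e.1.open_target.mem_nhds (e.1.map_source hx)] with z hz
    exact e.1.right_inv hz
  rw [this.fderiv_eq, fderiv_id]

lemma fderiv_transition_comp_symm {e e' : HolChart n X} {x : X} (hx : x ∈ e.1.source)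
    (hx' : x ∈ e'.1.source) :
    (fderiv ℂ (transition e' e) (e'.1 x)).comp (fderiv ℂ (transition e e') (e.1 x)) =
      ContinuousLinearMap.id ℂ _ := by
  rw [← fderiv_transition_comp hx hx' hx, fderiv_transition_self hx]

lemma jacobian_eq (e e' : HolChart n X) (z : Fin n → ℂ) :
    jacobian e e' z = (fderiv ℂ (transition e e') z).det := rfl

lemma jacobian_comp {e e' e'' : HolChart n X} {x : X} (hx : x ∈ e.1.source)
    (hx' : x ∈ e'.1.source) (hx'' : x ∈ e''.1.source) :
    jacobian e e'' (e.1 x) = jacobian e' e'' (e'.1 x) * jacobian e e' (e.1 x) := by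
  rw [jacobian_eq, fderiv_transition_comp hx hx' hx'']
  exact LinearMap.det_comp _ _

lemma jacobian_mul_symm {e e' : HolChart n X} {x : X} (hx : x ∈ e.1.source)
    (hx' : x ∈ e'.1.source) : jacobian e' e (e'.1 x) * jacobian e e' (e.1 x) = 1 := by
  rw [← jacobian_comp hx hx' hx, jacobian_eq, fderiv_transition_self hx]
  exact LinearMap.det_id

lemma jacobian_ne_zero {e e' : HolChart n X} {x : X} (hx : x ∈ e.1.source)
    (hx' : x ∈ e'.1.source) : jacobian e e' (e.1 x) ≠ 0 :=
  right_ne_zero_of_mul_eq_one (jacobian_mul_symm hx hx')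

/-- Writes the determinant as a polynomial in matrix entries, from which analyticity can be read
off. -/
lemma det_eq_matrix_det (L : (Fin n → ℂ) →L[ℂ] (Fin n → ℂ)) :
    L.det = (Matrix.of fun i j => L (Pi.single j 1) i).det := by
  rw [ContinuousLinearMap.det, ← LinearMap.det_toMatrix']
  congr 1

lemma analyticAt_matrix_det {E : Type*} [NormedAddCommGroup E] [NormedSpace ℂ E] {ι : Type*}
    [Fintype ι] [DecidableEq ι] {M : E → Matrix ι ι ℂ} {z : E}
    (h : ∀ i j, AnalyticAt ℂ (fun z => M z i j) z) : AnalyticAt ℂ (fun z => (M z).det) z := by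
  simp only [Matrix.det_apply]
  refine Finset.analyticAt_fun_sum _ fun σ _ => ?_
  have : AnalyticAt ℂ (fun z => ∏ i, M z (σ i) i) z :=
    Finset.analyticAt_fun_prod _ fun i _ => h _ _
  exact this.const_smul

lemma analyticAt_apply_coord {E : Type*} [NormedAddCommGroup E] [NormedSpace ℂ E]
    {f : E → (Fin n → ℂ)} {z : E} (h : AnalyticAt ℂ f z) (i : Fin n) :
    AnalyticAt ℂ (fun z => f z i) z :=
  ((ContinuousLinearMap.proj i : (Fin n → ℂ) →L[ℂ] ℂ).analyticAt _).comp h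

lemma _root_.AnalyticAt.clm_apply_analyticAt {E F G : Type*} [NormedAddCommGroup E]
    [NormedSpace ℂ E] [NormedAddCommGroup F] [NormedSpace ℂ F] [CompleteSpace F]
    [NormedAddCommGroup G] [NormedSpace ℂ G] [CompleteSpace G] {f : E → F →L[ℂ] G} {g : E → F} {z : E}
    (hf : AnalyticAt ℂ f z) (hg : AnalyticAt ℂ g z) : AnalyticAt ℂ (fun z => f z (g z)) z := by
  exact (ContDiffAt.clm_apply (n := ω) hf.contDiffAt hg.contDiffAt).analyticAt

lemma analyticAt_jacobian {e e' : HolChart n X} {x : X} (hx : x ∈ e.1.source)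
    (hx' : x ∈ e'.1.source) : AnalyticAt ℂ (jacobian e e') (e.1 x) := by
  have h : jacobian e e' = fun z =>
      (Matrix.of fun i j => fderiv ℂ (transition e e') z (Pi.single j 1) i).det := by
    funext z; exact det_eq_matrix_det _
  rw [h]
  refine analyticAt_matrix_det fun i j => ?_
  simp only [Matrix.of_apply]
  refine analyticAt_apply_coord ?_ i
  exact AnalyticAt.clm_apply_analyticAt (analyticAt_transition hx hx').fderiv analyticAt_const

end Charts

/-! ### Sections of powers of the anticanonical bundle, and their ratios. -/

section Sections

variable {n : ℕ} {X : Type*} [TopologicalSpace X] [ChartedSpace (Fin n → ℂ) X]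

lemma H0.analyticAt {k : ℕ} (s : H0 n X k) {e : HolChart n X} {x : X} (hx : x ∈ e.1.source) :
    AnalyticAt ℂ (s.1 e) (e.1 x) :=
  s.2.1 e _ (e.1.map_source hx)

lemma H0.differentiableAt {k : ℕ} (s : H0 n X k) {e : HolChart n X} {x : X}
    (hx : x ∈ e.1.source) : DifferentiableAt ℂ (s.1 e) (e.1 x) :=
  (H0.analyticAt s hx).differentiableAt

lemma H0.apply_eq {k : ℕ} (s : H0 n X k) {e e' : HolChart n X} {x : X} (hx : x ∈ e.1.source)
    (hx' : x ∈ e'.1.source) : s.1 e' (e'.1 x) = jacobian e e' (e.1 x) ^ k * s.1 e (e.1 x) :=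
  s.2.2.2 e e' x hx hx'

lemma H0.apply_eq_zero_iff {k : ℕ} (s : H0 n X k) {e e' : HolChart n X} {x : X}
    (hx : x ∈ e.1.source) (hx' : x ∈ e'.1.source) :
    s.1 e' (e'.1 x) = 0 ↔ s.1 e (e.1 x) = 0 := by
  rw [H0.apply_eq s hx hx', mul_eq_zero, or_iff_right (pow_ne_zero _ (jacobian_ne_zero hx hx'))]

lemma H0.ext_charts {k : ℕ} {s t : H0 n X k}
    (h : ∀ (e : HolChart n X) (x : X), x ∈ e.1.source → s.1 e (e.1 x) = t.1 e (e.1 x)) :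
    s = t := by
  apply Subtype.ext
  funext e z
  by_cases hz : z ∈ e.1.target
  · have := h e (e.1.symm z) (e.1.map_target hz)
    rwa [e.1.right_inv hz] at this
  · rw [s.2.2.1 e z hz, t.2.2.1 e z hz]

open Classical in
/-- The section with prescribed coefficients in all charts. -/
def H0.mk {k : ℕ} (f : HolChart n X → (Fin n → ℂ) → ℂ)
    (hf : ∀ (e : HolChart n X) (x : X), x ∈ e.1.source → AnalyticAt ℂ (f e) (e.1 x))
    (hf' : ∀ (e e' : HolChart n X) (x : X), x ∈ e.1.source → x ∈ e'.1.source →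
      f e' (e'.1 x) = jacobian e e' (e.1 x) ^ k * f e (e.1 x)) : H0 n X k :=
  -- The cut-off enforces the normalisation in `H0`, so `f` matters only on chart targets.
  ⟨fun e => e.1.target.indicator (f e), by
    refine ⟨fun e z hz => ?_, fun e z hz => Set.indicator_of_notMem hz _,
      fun e e' x hx hx' => ?_⟩
    · have h := hf e (e.1.symm z) (e.1.map_target hz)
      rw [e.1.right_inv hz] at h
      refine h.congr ?_
      filter_upwards [e.1.open_target.mem_nhds hz] with w hw
      rw [Set.indicator_of_mem hw]
    · simp only [Set.indicator_of_mem (e.1.map_source hx),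
        Set.indicator_of_mem (e'.1.map_source hx')]
      exact hf' e e' x hx hx'⟩

lemma H0.mk_apply {k : ℕ} {f : HolChart n X → (Fin n → ℂ) → ℂ}
    (hf : ∀ (e : HolChart n X) (x : X), x ∈ e.1.source → AnalyticAt ℂ (f e) (e.1 x))
    (hf' : ∀ (e e' : HolChart n X) (x : X), x ∈ e.1.source → x ∈ e'.1.source →
      f e' (e'.1 x) = jacobian e e' (e.1 x) ^ k * f e (e.1 x)) {e : HolChart n X} {x : X}
    (hx : x ∈ e.1.source) : (H0.mk f hf hf').1 e (e.1 x) = f e (e.1 x) :=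
  Set.indicator_of_mem (e.1.map_source hx) _

/-- The product of two sections. -/
def H0.mul {k l : ℕ} (s : H0 n X k) (t : H0 n X l) : H0 n X (k + l) :=
  H0.mk (fun e z => s.1 e z * t.1 e z) (fun _ _ hx => (H0.analyticAt s hx).mul (H0.analyticAt t hx))
    (fun e e' x hx hx' => by
      rw [H0.apply_eq s hx hx', H0.apply_eq t hx hx', pow_add]; ring)

lemma H0.mul_apply {k l : ℕ} (s : H0 n X k) (t : H0 n X l) {e : HolChart n X} {x : X}
    (hx : x ∈ e.1.source) : (H0.mul s t).1 e (e.1 x) = s.1 e (e.1 x) * t.1 e (e.1 x) :=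
  H0.mk_apply _ _ hx

/-- The `r`-th power of a section. -/
def H0.pow {k : ℕ} (s : H0 n X k) (r : ℕ) : H0 n X (k * r) :=
  H0.mk (fun e z => s.1 e z ^ r) (fun _ _ hx => (H0.analyticAt s hx).pow r)
    (fun e e' x hx hx' => by rw [H0.apply_eq s hx hx', mul_pow, pow_mul])

lemma H0.pow_apply {k : ℕ} (s : H0 n X k) (r : ℕ) {e : HolChart n X} {x : X}
    (hx : x ∈ e.1.source) : (H0.pow s r).1 e (e.1 x) = s.1 e (e.1 x) ^ r :=
  H0.mk_apply _ _ hx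

lemma H0.continuousOn_chart {k : ℕ} (s : H0 n X k) (e : HolChart n X) :
    ContinuousOn (fun x => s.1 e (e.1 x)) e.1.source := fun _ hx =>
  ((H0.analyticAt s hx).continuousAt.comp (e.1.continuousAt hx)).continuousWithinAt

variable [IsManifold 𝓘(ℂ, Fin n → ℂ) ω X]

variable (n) in
/-- The preferred chart at a point. -/
def chartH (x : X) : HolChart n X :=
  ⟨chartAt (Fin n → ℂ) x, IsManifold.chart_mem_maximalAtlas x⟩

lemma mem_chartH_source (x : X) : x ∈ (chartH n x).1.source := mem_chart_source _ x

/-- The nonvanishing locus of a section. -/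
def H0.support {k : ℕ} (s : H0 n X k) : Set X := {x | s.1 (chartH n x) ((chartH n x).1 x) ≠ 0}

lemma H0.mem_support_iff {k : ℕ} {s : H0 n X k} {e : HolChart n X} {x : X}
    (hx : x ∈ e.1.source) : x ∈ H0.support s ↔ s.1 e (e.1 x) ≠ 0 :=
  not_congr (H0.apply_eq_zero_iff s hx (mem_chartH_source x))

lemma H0.isOpen_support {k : ℕ} (s : H0 n X k) : IsOpen (H0.support s) := by
  rw [isOpen_iff_mem_nhds]
  intro x hx
  have h := mem_chartH_source (n := n) x
  have hc : ContinuousAt (fun y => s.1 (chartH n x) ((chartH n x).1 y)) x :=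
    (H0.continuousOn_chart s _).continuousAt ((chartH n x).1.open_source.mem_nhds h)
  filter_upwards [hc.eventually_ne hx, (chartH n x).1.open_source.mem_nhds h] with y hy hy'
  exact (H0.mem_support_iff hy').2 hy

/-- The meromorphic function `s / t`. -/
def H0.ratio {k : ℕ} (s t : H0 n X k) (x : X) : ℂ :=
  s.1 (chartH n x) ((chartH n x).1 x) / t.1 (chartH n x) ((chartH n x).1 x)

/-- The Jacobian factors of numerator and denominator cancel, so the ratio is a function on `X`. -/
lemma H0.ratio_eq {k : ℕ} (s t : H0 n X k) {e : HolChart n X} {x : X} (hx : x ∈ e.1.source) :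
    H0.ratio s t x = s.1 e (e.1 x) / t.1 e (e.1 x) := by
  have h := mem_chartH_source (n := n) x
  rw [H0.apply_eq s h hx, H0.apply_eq t h hx, H0.ratio, mul_div_mul_left]
  exact pow_ne_zero _ (jacobian_ne_zero h hx)

lemma H0.continuousOn_ratio {k : ℕ} (s t : H0 n X k) : ContinuousOn (H0.ratio s t) (H0.support t) := by
  intro x hx
  apply ContinuousAt.continuousWithinAt
  have h := mem_chartH_source (n := n) x
  have hn := (chartH n x).1.open_source.mem_nhds h
  have hc := ((H0.continuousOn_chart s (chartH n x)).continuousAt hn).div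
    ((H0.continuousOn_chart t (chartH n x)).continuousAt hn) hx
  refine hc.congr ?_
  filter_upwards [hn] with y hy
  exact (H0.ratio_eq s t hy).symm

lemma H0.measurable_ratio [MeasurableSpace X] [BorelSpace X] {k : ℕ} (s t : H0 n X k) :
    Measurable (H0.ratio s t) := by
  classical
  -- Division by zero returns `0`, so the ratio is continuous on the open support of `t` and zero
  -- elsewhere.
  have h : H0.ratio s t = (H0.support t).piecewise (H0.ratio s t) (fun _ => 0) := by
    funext x
    by_cases hx : x ∈ H0.support t
    · simp [hx]
    · have : t.1 (chartH n x) ((chartH n x).1 x) = 0 := not_not.1 hx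
      simp [hx, H0.ratio, this]
  rw [h]
  exact (H0.continuousOn_ratio s t).measurable_piecewise continuousOn_const
    (H0.isOpen_support t).measurableSet

end Sections

/-! ### Finite-dimensionality of the spaces of sections. -/

section FiniteDimension

variable {n : ℕ} {X : Type*} [TopologicalSpace X] [ChartedSpace (Fin n → ℂ) X]
  [IsManifold 𝓘(ℂ, Fin n → ℂ) ω X]

/-- A bound for sections on finitely many coordinate balls covering the manifold yields a bound on
every compact subset of a chart. -/
lemma exists_bound_on_compact {k : ℕ} (t : Finset X) (r : X → ℝ)
    (ht : ∀ x : X, ∃ y ∈ t, x ∈ (chartH n y).1.source ∧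
      (chartH n y).1 x ∈ Metric.ball ((chartH n y).1 y) (r y))
    (e : HolChart n X) {L : Set (Fin n → ℂ)} (hL : IsCompact L) (hLe : L ⊆ e.1.target) :
    ∃ C : ℝ, 0 ≤ C ∧ ∀ (s : H0 n X k) (B : ℝ), 0 ≤ B →
      (∀ y ∈ t, ∀ z ∈ Metric.closedBall ((chartH n y).1 y) (r y), ‖s.1 (chartH n y) z‖ ≤ B) →
      ∀ z ∈ L, ‖s.1 e z‖ ≤ C * B := by
  refine hL.induction_on (p := fun L => ∃ C : ℝ, 0 ≤ C ∧ ∀ (s : H0 n X k) (B : ℝ), 0 ≤ B →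
      (∀ y ∈ t, ∀ z ∈ Metric.closedBall ((chartH n y).1 y) (r y), ‖s.1 (chartH n y) z‖ ≤ B) →
      ∀ z ∈ L, ‖s.1 e z‖ ≤ C * B) ?_ ?_ ?_ ?_
  · exact ⟨0, le_rfl, fun _ _ _ _ z hz => absurd hz (Set.notMem_empty z)⟩
  · rintro L L' hLL' ⟨C, hC, h⟩
    exact ⟨C, hC, fun s B hB hs z hz => h s B hB hs z (hLL' hz)⟩
  · rintro L L' ⟨C, hC, h⟩ ⟨C', hC', h'⟩
    refine ⟨C + C', add_nonneg hC hC', fun s B hB hs z hz => ?_⟩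
    rcases hz with hz | hz
    · exact (h s B hB hs z hz).trans (mul_le_mul_of_nonneg_right (by linarith) hB)
    · exact (h' s B hB hs z hz).trans (mul_le_mul_of_nonneg_right (by linarith) hB)
  · intro w hw
    obtain ⟨x, hx, rfl⟩ : ∃ x ∈ e.1.source, e.1 x = w :=
      ⟨e.1.symm w, e.1.map_target (hLe hw), e.1.right_inv (hLe hw)⟩
    obtain ⟨y, hy, hxy, hxr⟩ := ht x
    -- Near `x` the Jacobian power stays above half its value at `x`; the inverse of that half is
    -- the local constant.
    have hj : ∀ᶠ z in 𝓝 (e.1 x),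
        ‖jacobian e (chartH n y) z ^ k‖ > ‖jacobian e (chartH n y) (e.1 x) ^ k‖ / 2 :=
      (((analyticAt_jacobian hx hxy).pow k).continuousAt.norm).eventually_const_lt
        (half_lt_self (norm_pos_iff.2 (pow_ne_zero _ (jacobian_ne_zero hx hxy))))
    have hb : ∀ᶠ z in 𝓝 (e.1 x), transition e (chartH n y) z ∈
        Metric.ball ((chartH n y).1 y) (r y) := by
      refine (analyticAt_transition hx hxy).continuousAt.eventually_mem
        (Metric.isOpen_ball.mem_nhds ?_)
      rwa [transition_apply _ hx]
    refine ⟨_, mem_nhdsWithin_of_mem_nhds (hj.and (hb.and (overlap_mem_nhds hx hxy))),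
      (‖jacobian e (chartH n y) (e.1 x) ^ k‖ / 2)⁻¹, by positivity, ?_⟩
    rintro s B hB hs z ⟨hz1, hz2, hz3⟩
    replace hz3 := mem_overlap.1 hz3
    have h1 := H0.apply_eq s (e.1.map_target hz3.1) hz3.2
    rw [e.1.right_inv hz3.1] at h1
    have h2 := hs y hy _ (Metric.ball_subset_closedBall hz2)
    rw [transition, h1, norm_mul] at h2
    have hpos : 0 < ‖jacobian e (chartH n y) (e.1 x) ^ k‖ / 2 :=
      half_pos (norm_pos_iff.2 (pow_ne_zero _ (jacobian_ne_zero hx hxy)))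
    rw [inv_mul_eq_div, le_div_iff₀ hpos, mul_comm]
    exact (mul_le_mul_of_nonneg_right hz1.le (norm_nonneg _)).trans h2

/-- The space of sections of a power of the anticanonical bundle of a compact manifold is
finite-dimensional. -/
instance finiteDimensional_H0 [CompactSpace X] (k : ℕ) : FiniteDimensional ℂ (H0 n X k) := by
  -- Strategy: evaluation on a fine finite net is injective. For a section vanishing on the net,
  -- Schwarz's lemma turns a bound `B` into `B / 2`; iterating gives zero.
  have h1 : ∀ x : X, ∃ r : ℝ, 0 < r ∧
      Metric.closedBall ((chartH n x).1 x) (2 * r) ⊆ (chartH n x).1.target := by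
    intro x
    obtain ⟨ε, hε, h⟩ := Metric.nhds_basis_closedBall.mem_iff.1
      ((chartH n x).1.open_target.mem_nhds ((chartH n x).1.map_source (mem_chartH_source x)))
    exact ⟨ε / 2, by positivity, by rwa [mul_div_cancel₀ _ two_ne_zero]⟩
  choose r hr hrt using h1
  obtain ⟨t, -, ht⟩ := isCompact_univ.elim_nhds_subcover
    (fun x => (chartH n x).1.source ∩ (chartH n x).1 ⁻¹' Metric.ball ((chartH n x).1 x) (r x))
    (fun x _ => ((chartH n x).1.isOpen_inter_preimage Metric.isOpen_ball).mem_nhds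
      ⟨mem_chartH_source x, Metric.mem_ball_self (hr x)⟩)
  have ht' : ∀ x : X, ∃ y ∈ t, x ∈ (chartH n y).1.source ∧
      (chartH n y).1 x ∈ Metric.ball ((chartH n y).1 y) (r y) := by
    intro x
    obtain ⟨y, hy, h⟩ := Set.mem_iUnion₂.1 (ht (Set.mem_univ x))
    exact ⟨y, hy, h.1, h.2⟩
  choose C hC hCs using fun y => exists_bound_on_compact (k := k) t r ht' (chartH n y)
    (isCompact_closedBall ((chartH n y).1 y) (2 * r y)) (hrt y)
  -- Mesh of the net: Schwarz's lemma on balls of radius `r y` yields the factor `2 * C y / r y *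
  -- δ`, which has to be at most `1 / 2`.
  have hδ : ∀ y, ∃ δ : ℝ, 0 < δ ∧ δ ≤ r y ∧ 2 * C y / r y * δ ≤ 1 / 2 := by
    intro y
    have hp : 0 < 4 * C y / r y + 1 := by have := hC y; have := hr y; positivity
    refine ⟨min (r y) (1 / (4 * C y / r y + 1)), lt_min (hr y) (by positivity), min_le_left _ _, ?_⟩
    have h2 : 0 ≤ 2 * C y / r y := by have := hC y; have := hr y; positivity
    calc 2 * C y / r y * min (r y) (1 / (4 * C y / r y + 1))
        ≤ 2 * C y / r y * (1 / (4 * C y / r y + 1)) :=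
          mul_le_mul_of_nonneg_left (min_le_right _ _) h2
      _ ≤ 1 / 2 := by
          rw [mul_one_div, div_le_iff₀ hp]
          have : 4 * C y / r y = 2 * (2 * C y / r y) := by ring
          linarith
  choose δ hδ hδr hδC using hδ
  choose F hFs hFf hF using fun y => finite_cover_balls_of_compact
    (isCompact_closedBall ((chartH n y).1 y) (r y)) (hδ y)
  -- a section vanishing on the finite net satisfies better and better bounds
  have key : ∀ s : H0 n X k, (∀ y ∈ t, ∀ z ∈ F y, s.1 (chartH n y) z = 0) → ∀ B : ℝ, 0 ≤ B →
      (∀ y ∈ t, ∀ z ∈ Metric.closedBall ((chartH n y).1 y) (r y), ‖s.1 (chartH n y) z‖ ≤ B) →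
      ∀ y ∈ t, ∀ z ∈ Metric.closedBall ((chartH n y).1 y) (r y),
        ‖s.1 (chartH n y) z‖ ≤ B / 2 := by
    intro s hs B hB hsB y hy z hz
    have hb := hCs y s B hB hsB
    obtain ⟨w, hw, hzw⟩ : ∃ w ∈ F y, z ∈ Metric.ball w (δ y) := by simpa using hF y hz
    have hsub : Metric.ball w (r y) ⊆ Metric.closedBall ((chartH n y).1 y) (2 * r y) := by
      intro u hu
      have h3 := hFs y hw
      rw [Metric.mem_closedBall] at h3 ⊢
      rw [Metric.mem_ball] at hu
      linarith [dist_triangle u w ((chartH n y).1 y)]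
    have h4 := Complex.dist_le_div_mul_dist_of_mapsTo_ball (f := s.1 (chartH n y)) (c := w)
      (R₁ := r y) (R₂ := 2 * C y * B) (z := z)
      (fun u hu => ((s.2.1 _ u (hrt y (hsub hu))).differentiableAt).differentiableWithinAt)
      (fun u hu => by
        rw [Metric.mem_closedBall, dist_eq_norm, hs y hy w hw, sub_zero]
        have := hb u (hsub hu)
        have := norm_nonneg (s.1 (chartH n y) u)
        linarith)
      (Metric.ball_subset_ball (hδr y) hzw)
    rw [dist_eq_norm, hs y hy w hw, sub_zero] at h4
    have h5 : 0 ≤ 2 * C y * B / r y := by have := hC y; have := hr y; positivity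
    calc _ ≤ _ := h4
      _ ≤ 2 * C y * B / r y * δ y := mul_le_mul_of_nonneg_left (Metric.mem_ball.1 hzw).le h5
      _ = 2 * C y / r y * δ y * B := by ring
      _ ≤ 1 / 2 * B := mul_le_mul_of_nonneg_right (hδC y) hB
      _ = B / 2 := by ring
  have hzero : ∀ s : H0 n X k, (∀ y ∈ t, ∀ z ∈ F y, s.1 (chartH n y) z = 0) → s = 0 := by
    intro s hs
    have hB0 : ∃ B : ℝ, 0 ≤ B ∧ ∀ y ∈ t, ∀ z ∈ Metric.closedBall ((chartH n y).1 y) (r y),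
        ‖s.1 (chartH n y) z‖ ≤ B := by
      have : ∀ y, ∃ B : ℝ, ∀ z ∈ Metric.closedBall ((chartH n y).1 y) (r y),
          ‖s.1 (chartH n y) z‖ ≤ B := fun y =>
        (isCompact_closedBall _ _).exists_bound_of_continuousOn fun z hz =>
          (s.2.1 _ z (hrt y (Metric.closedBall_subset_closedBall
            (by linarith [hr y]) hz))).continuousAt.continuousWithinAt
      choose B hB using this
      refine ⟨∑ y ∈ t, |B y|, Finset.sum_nonneg fun _ _ => abs_nonneg _, fun y hy z hz => ?_⟩
      exact (hB y z hz).trans ((le_abs_self _).trans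
        (Finset.single_le_sum (f := fun y => |B y|) (fun _ _ => abs_nonneg _) hy))
    obtain ⟨B, hB, hsB⟩ := hB0
    have hj : ∀ j : ℕ, ∀ y ∈ t, ∀ z ∈ Metric.closedBall ((chartH n y).1 y) (r y),
        ‖s.1 (chartH n y) z‖ ≤ B * (1 / 2) ^ j := by
      intro j
      induction j with
      | zero => simpa using hsB
      | succ j ih =>
        have := key s hs (B * (1 / 2) ^ j) (by positivity) ih
        convert this using 5
        ring
    refine H0.ext_charts fun e x hx => ?_
    obtain ⟨y, hy, hxy, hx'⟩ := ht' x
    have h0 : ‖s.1 (chartH n y) ((chartH n y).1 x)‖ ≤ 0 := by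
      have hlim : Tendsto (fun j : ℕ => B * (1 / 2 : ℝ) ^ j) atTop (𝓝 (B * 0)) :=
        (tendsto_pow_atTop_nhds_zero_of_lt_one (by norm_num) (by norm_num)).const_mul B
      rw [mul_zero] at hlim
      exact ge_of_tendsto' hlim fun j => hj j y hy _ (Metric.ball_subset_closedBall hx')
    exact (H0.apply_eq_zero_iff s hxy hx).2 (norm_le_zero_iff.1 h0)
  let Φ : H0 n X k →ₗ[ℂ] (∀ p : (Σ y : t, F y.1), ℂ) :=
    { toFun := fun s p => s.1 (chartH n p.1.1) p.2.1
      map_add' := fun _ _ => rfl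
      map_smul' := fun _ _ => rfl }
  have : ∀ y, Finite (F y) := fun y => (hFf y).to_subtype
  refine FiniteDimensional.of_injective Φ ((injective_iff_map_eq_zero Φ).2 fun s hs => ?_)
  exact hzero s fun y hy z hz => congrFun hs ⟨⟨y, hy⟩, ⟨z, hz⟩⟩

end FiniteDimension

/-! ### Wronskians, and non-zero sections in all large degrees. -/

section Wronskian

variable {n : ℕ} {X : Type*} [TopologicalSpace X] [ChartedSpace (Fin n → ℂ) X]

/-- The transformation rule of sections, in a neighbourhood of a point. -/
lemma H0.comp_transition_eventuallyEq {k : ℕ} (s : H0 n X k) {e e' : HolChart n X} {x : X}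
    (hx : x ∈ e.1.source) (hx' : x ∈ e'.1.source) :
    s.1 e' ∘ transition e e' =ᶠ[𝓝 (e.1 x)] fun z => jacobian e e' z ^ k * s.1 e z := by
  filter_upwards [overlap_mem_nhds hx hx'] with z hz
  rw [mem_overlap] at hz
  have h := H0.apply_eq s (e.1.map_target hz.1) hz.2
  rwa [e.1.right_inv hz.1] at h

/-- The transformation rule of the differentials of sections. -/
lemma H0.fderiv_transition {k : ℕ} (s : H0 n X k) {e e' : HolChart n X} {x : X}
    (hx : x ∈ e.1.source) (hx' : x ∈ e'.1.source) (u : Fin n → ℂ) :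
    fderiv ℂ (s.1 e') (e'.1 x) (fderiv ℂ (transition e e') (e.1 x) u) =
      fderiv ℂ (fun z => jacobian e e' z ^ k) (e.1 x) u * s.1 e (e.1 x) +
        jacobian e e' (e.1 x) ^ k * fderiv ℂ (s.1 e) (e.1 x) u := by
  have h := (H0.comp_transition_eventuallyEq s hx hx').fderiv_eq (𝕜 := ℂ)
  have hs : DifferentiableAt ℂ (s.1 e') (transition e e' (e.1 x)) := by
    rw [transition_apply _ hx]; exact H0.differentiableAt s hx'
  have hg : DifferentiableAt ℂ (fun z => jacobian e e' z ^ k) (e.1 x) :=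
    ((analyticAt_jacobian hx hx').pow k).differentiableAt
  rw [fderiv_comp _ hs (differentiableAt_transition hx hx'), transition_apply _ hx,
    fderiv_fun_mul hg (H0.differentiableAt s hx)] at h
  have := DFunLike.congr_fun h u
  simp only [ContinuousLinearMap.comp_apply, add_apply,
    smul_apply, smul_eq_mul] at this
  rw [this]; ring

/-- If the bundle is very ample, sections vanishing at a point have arbitrary differential. -/
lemma VeryAmple.exists_fderiv_eq {m : ℕ} (h : VeryAmple n X m) {e : HolChart n X} {x : X}
    (hx : x ∈ e.1.source) (ℓ : (Fin n → ℂ) →L[ℂ] ℂ) :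
    ∃ s : H0 n X m, s.1 e (e.1 x) = 0 ∧ fderiv ℂ (s.1 e) (e.1 x) = ℓ := by
  let W : Submodule ℂ (Module.Dual ℂ (Fin n → ℂ)) :=
    { carrier := {f | ∃ s : H0 n X m, s.1 e (e.1 x) = 0 ∧
        ∀ u, fderiv ℂ (s.1 e) (e.1 x) u = f u}
      zero_mem' := ⟨0, rfl, fun u => by
        change fderiv ℂ (fun _ => (0 : ℂ)) _ u = 0
        simp⟩
      add_mem' := by
        rintro f g ⟨s, hs, hs'⟩ ⟨t, ht, ht'⟩
        refine ⟨s + t, ?_, fun u => ?_⟩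
        · change s.1 e (e.1 x) + t.1 e (e.1 x) = 0
          rw [hs, ht, add_zero]
        · change fderiv ℂ (s.1 e + t.1 e) (e.1 x) u = _
          rw [fderiv_add (H0.differentiableAt s hx) (H0.differentiableAt t hx)]
          simp [hs', ht']
      smul_mem' := by
        rintro c f ⟨s, hs, hs'⟩
        refine ⟨c • s, ?_, fun u => ?_⟩
        · change c * s.1 e (e.1 x) = 0
          rw [hs, mul_zero]
        · change fderiv ℂ (c • s.1 e) (e.1 x) u = _
          rw [fderiv_const_smul (H0.differentiableAt s hx)]
          simp [hs'] }
  -- A functional killing a proper `W` is evaluation at some `u ≠ 0`, by reflexivity; this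
  -- contradicts the separation of tangent directions.
  have hW : W = ⊤ := by
    by_contra hne
    obtain ⟨f, hf, hfW⟩ := Submodule.exists_le_ker_of_lt_top W (lt_top_iff_ne_top.2 hne)
    obtain ⟨u, rfl⟩ := (Module.evalEquiv ℂ (Fin n → ℂ)).surjective f
    have hu : u ≠ 0 := by
      rintro rfl
      exact hf (map_zero _)
    obtain ⟨s, hs, hs0, hsu⟩ := h.2.2 x e hx u hu
    refine hsu ?_
    have : (fderiv ℂ (s e) (e.1 x) : (Fin n → ℂ) →ₗ[ℂ] ℂ) ∈ W := ⟨⟨s, hs⟩, hs0, fun _ => rfl⟩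
    exact hfW this
  have hℓ : (ℓ : (Fin n → ℂ) →ₗ[ℂ] ℂ) ∈ W := hW ▸ Submodule.mem_top
  obtain ⟨s, hs, hs'⟩ := hℓ
  exact ⟨s, hs, ContinuousLinearMap.ext hs'⟩

/-- The matrix of the values and of the partial derivatives of `n + 1` sections. -/
def wronskianMatrix {m : ℕ} (S : Unit ⊕ Fin n → H0 n X m) (e : HolChart n X) (z : Fin n → ℂ) :
    Matrix (Unit ⊕ Fin n) (Unit ⊕ Fin n) ℂ :=
  Matrix.of fun i j => Sum.elim (fun _ => (S j).1 e z)
    (fun a => fderiv ℂ ((S j).1 e) z (Pi.single a 1)) i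

lemma analyticAt_det_wronskianMatrix {m : ℕ} (S : Unit ⊕ Fin n → H0 n X m) (e : HolChart n X)
    (x : X) (hx : x ∈ e.1.source) :
    AnalyticAt ℂ (fun z => (wronskianMatrix S e z).det) (e.1 x) := by
  refine analyticAt_matrix_det fun i j => ?_
  rcases i with i | i
  · exact H0.analyticAt (S j) hx
  · exact AnalyticAt.clm_apply_analyticAt (H0.analyticAt (S j) hx).fderiv analyticAt_const

lemma sum_apply_single {L : (Fin n → ℂ) →L[ℂ] ℂ} (u : Fin n → ℂ) :
    ∑ a, u a * L (Pi.single a 1) = L u := by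
  conv_rhs => rw [← Finset.univ_sum_single u]
  rw [map_sum]
  refine Finset.sum_congr rfl fun a _ => ?_
  rw [← smul_eq_mul, ← map_smul, ← Pi.single_smul, smul_eq_mul, mul_one]

/-- Let `J` be the Jacobian. The value row is scaled by `J ^ m`; the derivative rows, after the
chain rule, are scaled by `J ^ m` up to multiples of the value row. Block triangular determinants
give `J * W' = J ^ (m * (n + 1)) * W`, and one factor `J` cancels. Positivity of `m` makes the
subtraction in the exponent exact. -/
lemma det_wronskianMatrix_transition {m : ℕ} (hm : 0 < m) (S : Unit ⊕ Fin n → H0 n X m)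
    (e e' : HolChart n X) (x : X) (hx : x ∈ e.1.source) (hx' : x ∈ e'.1.source) :
    (wronskianMatrix S e' (e'.1 x)).det =
      jacobian e e' (e.1 x) ^ (m * (n + 1) - 1) * (wronskianMatrix S e (e.1 x)).det := by
  set g := jacobian e e' (e.1 x) ^ m with hg
  let J : Matrix (Fin n) (Fin n) ℂ :=
    Matrix.of fun i j => fderiv ℂ (transition e e') (e.1 x) (Pi.single j 1) i
  have hJ : J.det = jacobian e e' (e.1 x) := (det_eq_matrix_det _).symm
  have key : Matrix.fromBlocks (1 : Matrix Unit Unit ℂ) 0 0 J.transpose *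
      wronskianMatrix S e' (e'.1 x) =
      Matrix.fromBlocks (g • (1 : Matrix Unit Unit ℂ)) 0
        (Matrix.of fun a _ =>
          fderiv ℂ (fun z => jacobian e e' z ^ m) (e.1 x) (Pi.single a 1))
        (g • (1 : Matrix (Fin n) (Fin n) ℂ)) * wronskianMatrix S e (e.1 x) := by
    ext i j
    rcases i with i | i
    · simp [Matrix.mul_apply, wronskianMatrix, H0.apply_eq (S j) hx hx', g]
    · simp only [Matrix.mul_apply, Fintype.sum_sum_type, Matrix.fromBlocks_apply₂₁,
        Matrix.fromBlocks_apply₂₂, wronskianMatrix, Matrix.of_apply, Sum.elim_inl, Sum.elim_inr,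
        Matrix.transpose_apply, J]
      rw [sum_apply_single, H0.fderiv_transition (S j) hx hx']
      simp [g, Matrix.one_apply]
  have hdet := congrArg Matrix.det key
  rw [Matrix.det_mul, Matrix.det_mul, Matrix.det_fromBlocks_zero₁₂, Matrix.det_fromBlocks_zero₁₂,
    Matrix.det_transpose, hJ] at hdet
  simp only [Matrix.det_one, Matrix.det_smul, one_mul, mul_one, Fintype.card_unit, pow_one,
    Fintype.card_fin] at hdet
  have hne := jacobian_ne_zero hx hx'
  apply mul_left_cancel₀ hne
  rw [hdet, ← mul_assoc, hg, ← pow_succ', ← pow_succ', ← pow_mul,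
    Nat.sub_add_cancel (Nat.mul_pos hm n.succ_pos)]

/-- The Wronskian of `n + 1` sections of `-m K_X`, a section of `-(m (n + 1) - 1) K_X`. -/
def wronskian {m : ℕ} (hm : 0 < m) (S : Unit ⊕ Fin n → H0 n X m) :
    H0 n X (m * (n + 1) - 1) :=
  H0.mk (fun e z => (wronskianMatrix S e z).det) (analyticAt_det_wronskianMatrix S)
    (det_wronskianMatrix_transition hm S)

/-- Take one section not vanishing at `x` and `n` sections vanishing there with differentials the
coordinate forms: the matrix is block triangular. -/
lemma VeryAmple.exists_wronskian_ne_zero {m : ℕ} (hm : 0 < m) (h : VeryAmple n X m)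
    {e : HolChart n X} {x : X} (hx : x ∈ e.1.source) :
    ∃ w : H0 n X (m * (n + 1) - 1), w.1 e (e.1 x) ≠ 0 := by
  obtain ⟨s₀, hs₀, hs₀'⟩ := h.1 x
  choose s hs hs' using fun i : Fin n =>
    h.exists_fderiv_eq hx (ContinuousLinearMap.proj i : (Fin n → ℂ) →L[ℂ] ℂ)
  refine ⟨wronskian hm (Sum.elim (fun _ => ⟨s₀, hs₀⟩) s), ?_⟩
  have hM : wronskianMatrix (Sum.elim (fun _ => ⟨s₀, hs₀⟩) s) e (e.1 x) =
      Matrix.fromBlocks (s₀ e (e.1 x) • (1 : Matrix Unit Unit ℂ)) 0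
        (Matrix.of fun a _ => fderiv ℂ (s₀ e) (e.1 x) (Pi.single a 1)) 1 := by
    ext i j
    rcases i with i | i <;> rcases j with j | j
    · simp [wronskianMatrix]
    · simp [wronskianMatrix, hs]
    · simp [wronskianMatrix]
    · simp [wronskianMatrix, hs', Pi.single_apply, Matrix.one_apply, eq_comm]
  rw [wronskian, H0.mk_apply _ _ hx, hM, Matrix.det_fromBlocks_zero₁₂]
  simpa using hs₀' e hx

/-- On a manifold with ample anticanonical bundle, `-k K_X` has a non-zero section for all large
`k`. -/
lemma AnticanonicalAmple.eventually_nontrivial_H0 [IsManifold 𝓘(ℂ, Fin n → ℂ) ω X] [Nonempty X]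
    (h : AnticanonicalAmple n X) : ∀ᶠ k : ℕ in atTop, Nontrivial (H0 n X k) := by
  obtain ⟨m, hm, h⟩ := h
  obtain ⟨x⟩ := ‹Nonempty X›
  have hx := mem_chartH_source (n := n) x
  obtain ⟨s, hs, hs0⟩ := h.1 x
  obtain ⟨w, hw⟩ := h.exists_wronskian_ne_zero hm hx
  filter_upwards [eventually_ge_atTop (m * (m * (n + 1)))] with k hk
  -- Since `m * (n + 1) - 1 ≡ -1` modulo `m`, choose `b ≤ m` with `m ∣ k + b`; then `a = (k + b) / m
  -- - (n + 1) * b`, which is non-negative by the lower bound on `k`.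
  obtain ⟨a, b, rfl⟩ : ∃ a b, k = m * a + (m * (n + 1) - 1) * b := by
    obtain ⟨b, hb, c, hc⟩ : ∃ b ≤ m, m ∣ k + b := by
      refine ⟨m - k % m, Nat.sub_le _ _, ?_⟩
      have h1 := (Nat.mod_lt k hm).le
      have h2 := Nat.div_add_mod k m
      exact ⟨k / m + 1, by rw [mul_add]; omega⟩
    have h1 : (n + 1) * b ≤ c := by
      have h2 : m * ((n + 1) * b) ≤ m * c := by
        rw [← hc]
        calc m * ((n + 1) * b) ≤ m * ((n + 1) * m) := by gcongr
          _ = m * (m * (n + 1)) := by ring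
          _ ≤ k + b := by omega
      exact Nat.le_of_mul_le_mul_left h2 hm
    obtain ⟨d, rfl⟩ := Nat.exists_eq_add_of_le h1
    refine ⟨d, b, ?_⟩
    have h3 : 1 ≤ m * (n + 1) := Nat.mul_pos hm n.succ_pos
    obtain ⟨q, hq⟩ := Nat.exists_eq_add_of_le h3
    rw [hq, Nat.add_sub_cancel_left]
    have h4 : m * ((n + 1) * b + d) = m * (n + 1) * b + m * d := by ring
    rw [h4, hq] at hc
    linarith
  refine ⟨H0.mul (H0.pow ⟨s, hs⟩ a) (H0.pow w b), 0, fun h0 => ?_⟩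
  have h1 := congrArg (fun t : H0 n X _ => t.1 (chartH n x) ((chartH n x).1 x)) h0
  simp only [H0.mul_apply _ _ hx, H0.pow_apply _ _ hx] at h1
  exact mul_ne_zero (pow_ne_zero _ (hs0 _ hx)) (pow_ne_zero _ hw) h1

lemma AnticanonicalAmple.eventually_Nk_pos [IsManifold 𝓘(ℂ, Fin n → ℂ) ω X] [Nonempty X]
    [CompactSpace X] (h : AnticanonicalAmple n X) : ∀ᶠ k : ℕ in atTop, 0 < Nk n X k := by
  filter_upwards [h.eventually_nontrivial_H0] with k hk
  exact Module.finrank_pos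

end Wronskian

/-! ### Holomorphic vector fields, divergence and Lie derivative. -/

section VectorFields

/-- A holomorphic vector field, given by its coefficients in all holomorphic charts. -/
structure VField (n : ℕ) (X : Type*) [TopologicalSpace X] [ChartedSpace (Fin n → ℂ) X] where
  /-- The coefficients of the vector field in a chart. -/
  coeff : HolChart n X → (Fin n → ℂ) → (Fin n → ℂ)
  analyticAt' : ∀ (e : HolChart n X) (x : X), x ∈ e.1.source → AnalyticAt ℂ (coeff e) (e.1 x)
  apply_eq' : ∀ (e e' : HolChart n X) (x : X), x ∈ e.1.source → x ∈ e'.1.source →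
    coeff e' (e'.1 x) = fderiv ℂ (transition e e') (e.1 x) (coeff e (e.1 x))

variable {n : ℕ} {X : Type*} [TopologicalSpace X] [ChartedSpace (Fin n → ℂ) X]

/-- The trace of an endomorphism of `ℂⁿ`. -/
def coordTrace (L : (Fin n → ℂ) →L[ℂ] (Fin n → ℂ)) : ℂ := ∑ i, L (Pi.single i 1) i

lemma coordTrace_eq (L : (Fin n → ℂ) →L[ℂ] (Fin n → ℂ)) :
    coordTrace L = LinearMap.trace ℂ _ (L : (Fin n → ℂ) →ₗ[ℂ] (Fin n → ℂ)) := by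
  rw [LinearMap.trace_eq_matrix_trace ℂ (Pi.basisFun ℂ (Fin n)), Matrix.trace, coordTrace]
  simp

lemma coordTrace_add (L M : (Fin n → ℂ) →L[ℂ] (Fin n → ℂ)) :
    coordTrace (L + M) = coordTrace L + coordTrace M := by
  simp [coordTrace, Finset.sum_add_distrib]

lemma coordTrace_comp_comm (L M : (Fin n → ℂ) →L[ℂ] (Fin n → ℂ)) :
    coordTrace (L.comp M) = coordTrace (M.comp L) := by
  rw [coordTrace_eq, coordTrace_eq]
  exact LinearMap.trace_mul_comm ℂ (L : (Fin n → ℂ) →ₗ[ℂ] (Fin n → ℂ)) M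

lemma analyticAt_det (L : (Fin n → ℂ) →L[ℂ] (Fin n → ℂ)) :
    AnalyticAt ℂ (fun L : (Fin n → ℂ) →L[ℂ] (Fin n → ℂ) => L.det) L := by
  simp only [det_eq_matrix_det]
  refine analyticAt_matrix_det fun i j => analyticAt_apply_coord ?_ i
  exact AnalyticAt.clm_apply_analyticAt analyticAt_id analyticAt_const

/-- Compare the derivative along `I + t • H` with the expansion `det (1 + t M) = 1 + t * tr M + O(t
^ 2)`. -/
lemma fderiv_det_id (H : (Fin n → ℂ) →L[ℂ] (Fin n → ℂ)) :
    fderiv ℂ (fun L : (Fin n → ℂ) →L[ℂ] (Fin n → ℂ) => L.det) (ContinuousLinearMap.id ℂ _) H =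
      coordTrace H := by
  set I := ContinuousLinearMap.id ℂ (Fin n → ℂ)
  have h1 : HasDerivAt (fun t : ℂ => (I + t • H).det)
      (fderiv ℂ (fun L : (Fin n → ℂ) →L[ℂ] (Fin n → ℂ) => L.det) I H) 0 := by
    have hl : HasDerivAt (fun t : ℂ => I + t • H) H 0 := by
      simpa using ((hasDerivAt_id (0 : ℂ)).smul_const H).const_add I
    exact (analyticAt_det I).differentiableAt.hasFDerivAt.comp_hasDerivAt_of_eq (0 : ℂ) hl
      (by ext i j; simp)
  set M : Matrix (Fin n) (Fin n) ℂ := Matrix.of fun i j => H (Pi.single j 1) i with hM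
  have h2 : HasDerivAt (fun t : ℂ => (I + t • H).det) M.trace 0 := by
    have h3 : ∀ t : ℂ, (I + t • H).det = (1 + t • M).det := by
      intro t
      rw [det_eq_matrix_det]
      congr 1
      ext i j
      simp [I, M, Matrix.one_apply, Pi.single_apply]
    simp only [h3]
    rw [show (fun t : ℂ => (1 + t • M).det) = _ from
      funext fun t => Matrix.det_one_add_smul t M]
    set p := (Matrix.det (1 + (Polynomial.X : Polynomial ℂ) • M.map Polynomial.C)).divX.divX
    have h4 := (((hasDerivAt_id (0 : ℂ)).const_mul M.trace).const_add 1).add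
      ((p.hasDerivAt 0).mul ((hasDerivAt_id (0 : ℂ)).pow 2))
    exact h4.congr_deriv (by simp)
  rw [h1.unique h2]
  simp [Matrix.trace, M, coordTrace]

/-- Jacobi's formula for the Jacobian of a change of coordinates. -/
lemma fderiv_jacobian {e e' : HolChart n X} {x : X} (hx : x ∈ e.1.source)
    (hx' : x ∈ e'.1.source) (v : Fin n → ℂ) :
    fderiv ℂ (jacobian e e') (e.1 x) v = jacobian e e' (e.1 x) *
      coordTrace ((fderiv ℂ (transition e' e) (e'.1 x)).comp
        (fderiv ℂ (fderiv ℂ (transition e e')) (e.1 x) v)) := by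
  set P := fderiv ℂ (transition e e') (e.1 x) with hP
  set Q := fderiv ℂ (transition e' e) (e'.1 x) with hQ
  have hQP : Q.comp P = ContinuousLinearMap.id ℂ _ := fderiv_transition_comp_symm hx hx'
  have hPQ : P.comp Q = ContinuousLinearMap.id ℂ _ := fderiv_transition_comp_symm hx' hx
  -- Factoring out the constant `P` moves the base point of the determinant to the identity, where
  -- its derivative is the trace.
  have h1 : jacobian e e' = fun z => P.det * (Q.comp (fderiv ℂ (transition e e') z)).det := by
    funext z
    have : (Q.comp (fderiv ℂ (transition e e') z)).det =
        Q.det * (fderiv ℂ (transition e e') z).det := LinearMap.det_comp _ _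
    have h2 : P.det * Q.det = 1 := by
      have : (P.comp Q).det = P.det * Q.det := LinearMap.det_comp _ _
      rw [← this, hPQ]
      exact LinearMap.det_id
    rw [this, ← mul_assoc, h2, one_mul, jacobian_eq]
  have hd : HasFDerivAt (fun z => Q.comp (fderiv ℂ (transition e e') z))
      ((ContinuousLinearMap.compL ℂ (Fin n → ℂ) (Fin n → ℂ) (Fin n → ℂ) Q).comp
        (fderiv ℂ (fderiv ℂ (transition e e')) (e.1 x))) (e.1 x) :=
    (ContinuousLinearMap.compL ℂ (Fin n → ℂ) (Fin n → ℂ) (Fin n → ℂ) Q).hasFDerivAt.comp _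
      (analyticAt_transition hx hx').fderiv.differentiableAt.hasFDerivAt
  have hdet := (analyticAt_det (Q.comp P)).differentiableAt.hasFDerivAt
  have h3 := (hdet.comp (e.1 x) hd).const_mul P.det
  have h4 := h3.congr_of_eventuallyEq (f₁ := jacobian e e') (.of_eq h1)
  rw [h4.fderiv, jacobian_eq, ← hP]
  simp only [smul_apply, smul_eq_mul, ContinuousLinearMap.comp_apply, hQP, fderiv_det_id]
  rfl

namespace VField

variable (V : VField n X)

/-- The divergence of a vector field in a chart. -/
def div (e : HolChart n X) (z : Fin n → ℂ) : ℂ := coordTrace (fderiv ℂ (V.coeff e) z)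

lemma analyticAt_div {e : HolChart n X} {x : X} (hx : x ∈ e.1.source) :
    AnalyticAt ℂ (V.div e) (e.1 x) := by
  unfold div coordTrace
  refine Finset.analyticAt_fun_sum _ fun i _ => analyticAt_apply_coord ?_ i
  exact AnalyticAt.clm_apply_analyticAt (V.analyticAt' e x hx).fderiv analyticAt_const

lemma coeff_comp_transition {e e' : HolChart n X} {x : X} (hx : x ∈ e.1.source)
    (hx' : x ∈ e'.1.source) : V.coeff e' ∘ transition e e' =ᶠ[𝓝 (e.1 x)]
      fun z => fderiv ℂ (transition e e') z (V.coeff e z) := by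
  filter_upwards [overlap_mem_nhds hx hx'] with z hz
  rw [mem_overlap] at hz
  have h := V.apply_eq' e e' _ (e.1.map_target hz.1) hz.2
  rwa [e.1.right_inv hz.1] at h

/-- The divergence is not chart-independent: its defect is the logarithmic derivative of the
Jacobian along `V`. This is what the zeroth-order term of the Lie derivative has to compensate. -/
lemma div_transition {e e' : HolChart n X} {x : X} (hx : x ∈ e.1.source)
    (hx' : x ∈ e'.1.source) :
    jacobian e e' (e.1 x) * V.div e' (e'.1 x) =
      fderiv ℂ (jacobian e e') (e.1 x) (V.coeff e (e.1 x)) +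
        jacobian e e' (e.1 x) * V.div e (e.1 x) := by
  set P := fderiv ℂ (transition e e') (e.1 x) with hP
  set Q := fderiv ℂ (transition e' e) (e'.1 x) with hQ
  set H := fderiv ℂ (fderiv ℂ (transition e e')) (e.1 x) (V.coeff e (e.1 x)) with hH
  have hQP : Q.comp P = ContinuousLinearMap.id ℂ _ := fderiv_transition_comp_symm hx hx'
  have hPQ : P.comp Q = ContinuousLinearMap.id ℂ _ := fderiv_transition_comp_symm hx' hx
  have hψ := analyticAt_transition hx hx'
  have hsymm : IsSymmSndFDerivAt ℂ (transition e e') (e.1 x) :=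
    (hψ.contDiffAt (n := ω)).isSymmSndFDerivAt le_top
  -- Differentiating the transformation rule produces a second derivative with `V` in the wrong
  -- slot; symmetry turns it into `H`.
  have h1 : (fderiv ℂ (V.coeff e') (e'.1 x)).comp P = H + P.comp (fderiv ℂ (V.coeff e) (e.1 x)) := by
    have h := (V.coeff_comp_transition hx hx').fderiv_eq (𝕜 := ℂ)
    rw [fderiv_comp _ (by
      rw [transition_apply _ hx]; exact (V.analyticAt' _ _ hx').differentiableAt)
      hψ.differentiableAt, transition_apply _ hx] at h
    rw [h, fderiv_clm_apply hψ.fderiv.differentiableAt (V.analyticAt' _ _ hx).differentiableAt,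
      add_comm]
    congr 1
    ext1 u
    exact hsymm u _
  have h2 : V.div e' (e'.1 x) = coordTrace (Q.comp H) + V.div e (e.1 x) := by
    have h3 : fderiv ℂ (V.coeff e') (e'.1 x) =
        (H + P.comp (fderiv ℂ (V.coeff e) (e.1 x))).comp Q := by
      rw [← h1, ContinuousLinearMap.comp_assoc, hPQ, ContinuousLinearMap.comp_id]
    rw [div, h3, ContinuousLinearMap.add_comp, coordTrace_add, coordTrace_comp_comm H,
      coordTrace_comp_comm _ Q, ← ContinuousLinearMap.comp_assoc, hQP,
      ContinuousLinearMap.id_comp, div]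
  rw [h2, fderiv_jacobian hx hx', mul_add]

lemma analyticAt_lieDeriv {k : ℕ} (s : H0 n X k) (e : HolChart n X) (x : X)
    (hx : x ∈ e.1.source) :
    AnalyticAt ℂ (fun z => fderiv ℂ (s.1 e) z (V.coeff e z) - k * V.div e z * s.1 e z) (e.1 x) := by
  refine AnalyticAt.sub ?_ ((analyticAt_const.mul (V.analyticAt_div hx)).mul
    (H0.analyticAt s hx))
  exact AnalyticAt.clm_apply_analyticAt (H0.analyticAt s hx).fderiv (V.analyticAt' e x hx)

/-- Differentiating `J ^ k` along `V` yields `k * J ^ (k - 1) * V(J) * s`, which cancels against `k`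
times the defect of the divergence. -/
lemma lieDeriv_transition {k : ℕ} (s : H0 n X k) (e e' : HolChart n X) (x : X)
    (hx : x ∈ e.1.source) (hx' : x ∈ e'.1.source) :
    fderiv ℂ (s.1 e') (e'.1 x) (V.coeff e' (e'.1 x)) - k * V.div e' (e'.1 x) * s.1 e' (e'.1 x) =
      jacobian e e' (e.1 x) ^ k * (fderiv ℂ (s.1 e) (e.1 x) (V.coeff e (e.1 x)) -
        k * V.div e (e.1 x) * s.1 e (e.1 x)) := by
  rw [V.apply_eq' e e' x hx hx', H0.fderiv_transition s hx hx', H0.apply_eq s hx hx']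
  have h1 := V.div_transition hx hx'
  have h2 : fderiv ℂ (fun z => jacobian e e' z ^ k) (e.1 x) (V.coeff e (e.1 x)) =
      k * jacobian e e' (e.1 x) ^ (k - 1) *
        fderiv ℂ (jacobian e e') (e.1 x) (V.coeff e (e.1 x)) := by
    rw [fderiv_fun_pow k (analyticAt_jacobian hx hx').differentiableAt]
    simp [mul_assoc]
  rw [h2]
  -- The exponent `k - 1` is truncated at `k = 0`, where both sides have no divergence term.
  rcases k with _ | k
  · simp
  · rw [Nat.add_sub_cancel, pow_succ]
    push_cast
    linear_combination (-(k + 1 : ℂ) * jacobian e e' (e.1 x) ^ k * s.1 e (e.1 x)) * h1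

/-- The Lie derivative of sections of a power of the anticanonical bundle. -/
def lieDeriv (k : ℕ) : H0 n X k →ₗ[ℂ] H0 n X k where
  toFun s := H0.mk _ (V.analyticAt_lieDeriv s) (V.lieDeriv_transition s)
  map_add' s t := H0.ext_charts fun e x hx => by
    rw [H0.mk_apply _ _ hx]
    change _ = (H0.mk _ _ _).1 e (e.1 x) + (H0.mk _ _ _).1 e (e.1 x)
    rw [H0.mk_apply _ _ hx, H0.mk_apply _ _ hx]
    change fderiv ℂ (s.1 e + t.1 e) (e.1 x) _ - _ * (s.1 e (e.1 x) + t.1 e (e.1 x)) = _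
    rw [fderiv_add (H0.differentiableAt s hx) (H0.differentiableAt t hx), add_apply]
    ring
  map_smul' c s := H0.ext_charts fun e x hx => by
    rw [H0.mk_apply _ _ hx]
    change _ = c * (H0.mk _ _ _).1 e (e.1 x)
    rw [H0.mk_apply _ _ hx]
    change fderiv ℂ (c • s.1 e) (e.1 x) _ - _ * (c * s.1 e (e.1 x)) = _
    rw [fderiv_const_smul (H0.differentiableAt s hx), smul_apply, smul_eq_mul]
    ring

lemma lieDeriv_apply {k : ℕ} (s : H0 n X k) {e : HolChart n X} {x : X} (hx : x ∈ e.1.source) :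
    (V.lieDeriv k s).1 e (e.1 x) = fderiv ℂ (s.1 e) (e.1 x) (V.coeff e (e.1 x)) -
      k * V.div e (e.1 x) * s.1 e (e.1 x) :=
  H0.mk_apply (V.analyticAt_lieDeriv s) (V.lieDeriv_transition s) hx

end VField

variable [IsManifold 𝓘(ℂ, Fin n → ℂ) ω X]

/-- The coefficients of a section of the tangent bundle in a chart. -/
def tangentCoeff (v : ∀ x : X, TangentSpace 𝓘(ℂ, Fin n → ℂ) x) (e : HolChart n X)
    (z : Fin n → ℂ) : Fin n → ℂ :=
  fderiv ℂ (transition (chartH n (e.1.symm z)) e)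
    ((chartH n (e.1.symm z)).1 (e.1.symm z)) (v (e.1.symm z))

lemma tangentCoeff_apply (v : ∀ x : X, TangentSpace 𝓘(ℂ, Fin n → ℂ) x) {e : HolChart n X}
    {x : X} (hx : x ∈ e.1.source) : tangentCoeff v e (e.1 x) =
      fderiv ℂ (transition (chartH n x) e) ((chartH n x).1 x) (v x) := by
  rw [tangentCoeff, e.1.left_inv hx]

lemma tangentCoeff_transition (v : ∀ x : X, TangentSpace 𝓘(ℂ, Fin n → ℂ) x)
    (e e' : HolChart n X) (x : X) (hx : x ∈ e.1.source) (hx' : x ∈ e'.1.source) :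
    tangentCoeff v e' (e'.1 x) =
      fderiv ℂ (transition e e') (e.1 x) (tangentCoeff v e (e.1 x)) := by
  rw [tangentCoeff_apply v hx', tangentCoeff_apply v hx,
    fderiv_transition_comp (mem_chartH_source x) hx hx']
  rfl

/-- The trivialization of the tangent bundle at `x` is given by derivatives of coordinate changes
into the preferred chart, so it reads `v` as `tangentCoeff`. -/
lemma analyticAt_tangentCoeff_chartH {v : ∀ x : X, TangentSpace 𝓘(ℂ, Fin n → ℂ) x}
    (hv : ContMDiff 𝓘(ℂ, Fin n → ℂ) 𝓘(ℂ, Fin n → ℂ).tangent ω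
      (fun x => (⟨x, v x⟩ : TangentBundle 𝓘(ℂ, Fin n → ℂ) X))) (x : X) :
    AnalyticAt ℂ (tangentCoeff v (chartH n x)) ((chartH n x).1 x) := by
  have h1 := (Bundle.contMDiffAt_section x).1 (hv x)
  have hx := mem_chartH_source (n := n) x
  have h2 : ContMDiffAt 𝓘(ℂ, Fin n → ℂ) 𝓘(ℂ, Fin n → ℂ) ω (chartH n x).1.symm
      ((chartH n x).1 x) :=
    contMDiffAt_symm_of_mem_maximalAtlas (chartH n x).2 ((chartH n x).1.map_source hx)
  have h3 := ContMDiffAt.comp_of_eq h1 h2 ((chartH n x).1.left_inv hx)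
  refine (contMDiffAt_iff_contDiffAt.1 h3).analyticAt.congr ?_
  filter_upwards [(chartH n x).1.open_target.mem_nhds ((chartH n x).1.map_source hx)] with z hz
  simp only [Function.comp, TangentBundle.trivializationAt_apply]
  simp [tangentCoeff]
  rfl

/-- The coefficients of a holomorphic section of the tangent bundle. -/
def VField.ofContMDiff {v : ∀ x : X, TangentSpace 𝓘(ℂ, Fin n → ℂ) x}
    (hv : ContMDiff 𝓘(ℂ, Fin n → ℂ) 𝓘(ℂ, Fin n → ℂ).tangent ω
      (fun x => (⟨x, v x⟩ : TangentBundle 𝓘(ℂ, Fin n → ℂ) X))) : VField n X where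
  coeff := tangentCoeff v
  apply_eq' := tangentCoeff_transition v
  analyticAt' e x hx := by
    have h0 := mem_chartH_source (n := n) x
    -- The transformation rule carries analyticity from the preferred chart at `x` to an arbitrary
    -- chart.
    have h1 : (fun z => fderiv ℂ (transition (chartH n x) e) (transition e (chartH n x) z)
        (tangentCoeff v (chartH n x) (transition e (chartH n x) z))) =ᶠ[𝓝 (e.1 x)]
        tangentCoeff v e := by
      filter_upwards [overlap_mem_nhds hx h0] with z hz
      rw [mem_overlap] at hz
      have := tangentCoeff_transition v (chartH n x) e _ hz.2 (e.1.map_target hz.1)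
      rw [e.1.right_inv hz.1] at this
      exact this.symm
    refine AnalyticAt.congr ?_ h1
    have ht := analyticAt_transition hx h0
    refine AnalyticAt.clm_apply_analyticAt ?_ ?_
    · refine AnalyticAt.fun_comp ?_ ht
      rw [transition_apply _ hx]
      exact (analyticAt_transition h0 hx).fderiv
    · refine AnalyticAt.fun_comp ?_ ht
      rw [transition_apply _ hx]
      exact analyticAt_tangentCoeff_chartH hv x

lemma VField.ofContMDiff_coeff {v : ∀ x : X, TangentSpace 𝓘(ℂ, Fin n → ℂ) x}
    (hv : ContMDiff 𝓘(ℂ, Fin n → ℂ) 𝓘(ℂ, Fin n → ℂ).tangent ω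
      (fun x => (⟨x, v x⟩ : TangentBundle 𝓘(ℂ, Fin n → ℂ) X))) (x : X) :
    (VField.ofContMDiff hv).coeff (chartH n x) ((chartH n x).1 x) = v x := by
  change tangentCoeff v _ _ = _
  rw [tangentCoeff_apply v (mem_chartH_source x), fderiv_transition_self (mem_chartH_source x)]
  rfl

end VectorFields

/-! ### Exponentials of bounded operators. -/

section OperatorExponential

variable {W : Type*} [NormedAddCommGroup W] [NormedSpace ℂ W]

/-- The one-parameter group generated by a bounded operator. -/
def expFlow (L : W →L[ℂ] W) (t : ℂ) : W →L[ℂ] W := NormedSpace.exp (t • L)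

lemma expFlow_zero (L : W →L[ℂ] W) : expFlow L 0 = 1 := by
  rw [expFlow, zero_smul, NormedSpace.exp_zero]

variable [CompleteSpace W]

lemma expFlow_add (L : W →L[ℂ] W) (s t : ℂ) : expFlow L (s + t) = expFlow L s * expFlow L t := by
  let _ : NormedAlgebra ℚ (W →L[ℂ] W) := NormedAlgebra.restrictScalars ℚ ℂ _
  rw [expFlow, add_smul, NormedSpace.exp_add_of_commute]
  · rfl
  · exact ((Commute.refl L).smul_left s).smul_right t

lemma expFlow_apply_add (L : W →L[ℂ] W) (s t : ℂ) (ξ : W) :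
    expFlow L (s + t) ξ = expFlow L s (expFlow L t ξ) := by
  rw [expFlow_add]; rfl

lemma expFlow_neg_apply (L : W →L[ℂ] W) (t : ℂ) (ξ : W) :
    expFlow L (-t) (expFlow L t ξ) = ξ := by
  rw [← expFlow_apply_add, neg_add_cancel, expFlow_zero]; rfl

lemma expFlow_apply_neg (L : W →L[ℂ] W) (t : ℂ) (ξ : W) :
    expFlow L t (expFlow L (-t) ξ) = ξ := by
  rw [← expFlow_apply_add, add_neg_cancel, expFlow_zero]; rfl

lemma expFlow_apply_ne_zero (L : W →L[ℂ] W) (t : ℂ) {ξ : W} (hξ : ξ ≠ 0) :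
    expFlow L t ξ ≠ 0 := fun h => hξ <| by
  rw [← expFlow_neg_apply L t ξ, h, map_zero]

lemma hasDerivAt_expFlow (L : W →L[ℂ] W) (t : ℂ) :
    HasDerivAt (expFlow L) (expFlow L t * L) t :=
  hasDerivAt_exp_smul_const (𝕂 := ℂ) L t

lemma hasDerivAt_expFlow' (L : W →L[ℂ] W) (t : ℂ) :
    HasDerivAt (expFlow L) (L * expFlow L t) t :=
  hasDerivAt_exp_smul_const' (𝕂 := ℂ) L t

lemma continuous_expFlow (L : W →L[ℂ] W) : Continuous (expFlow L) :=
  continuous_iff_continuousAt.2 fun t => (hasDerivAt_expFlow L t).continuousAt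

/-- A solution of the linear equation `ζ' = c L ζ` is given by the exponential. -/
lemma eq_expFlow_of_hasDerivAt (L : W →L[ℂ] W) (c : ℂ) {ζ : ℝ → W} {ε : ℝ}
    (hζ : ∀ t ∈ Set.Ioo (-ε) ε, HasDerivAt ζ (c • L (ζ t)) t) {t : ℝ} (ht : t ∈ Set.Ioo (-ε) ε) :
    ζ t = expFlow L (t * c) (ζ 0) := by
  have h0 : (0 : ℝ) ∈ Set.Ioo (-ε) ε := by
    constructor <;> linarith [ht.1, ht.2]
  -- Undoing the flow, `exp (-s c L) (ζ s)` has zero derivative and is therefore constant.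
  have h1 : ∀ s ∈ Set.Ioo (-ε) ε,
      HasDerivAt (fun s : ℝ => expFlow L (-(s * c)) (ζ s)) 0 s := by
    intro s hs
    have hm : HasDerivAt (fun s : ℝ => -((s : ℂ) * c)) (-c) s := by
      exact ((Complex.ofRealCLM.hasDerivAt (x := s)).mul_const c).neg.congr_deriv (by simp)
    have hE : HasDerivAt (fun s : ℝ => expFlow L (-((s : ℂ) * c)))
        ((-c) • (expFlow L (-((s : ℂ) * c)) * L)) s :=
      (hasDerivAt_expFlow L _).scomp s hm
    have h2 := ((ContinuousLinearMap.restrictScalarsL ℂ W W ℝ ℝ).hasFDerivAt.comp_hasDerivAt s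
      hE).clm_apply (hζ s hs)
    refine h2.congr_deriv ?_
    simp
  have h2 : expFlow L (-(t * c)) (ζ t) = expFlow L (-((0 : ℝ) * c)) (ζ 0) :=
    isOpen_Ioo.is_const_of_deriv_eq_zero isPreconnected_Ioo
      (fun s hs => (h1 s hs).differentiableAt.differentiableWithinAt)
      (fun s hs => (h1 s hs).deriv) ht h0
  rw [Complex.ofReal_zero, zero_mul, neg_zero, expFlow_zero] at h2
  rw [← expFlow_apply_neg L (t * c) (ζ t), h2]
  rfl

lemma comp_expFlow_of_eigenvector (L : W →L[ℂ] W) {f : W →L[ℂ] ℂ} {μ : ℂ}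
    (hf : ∀ ξ, f (L ξ) = μ * f ξ) (t : ℂ) (ξ : W) :
    f (expFlow L t ξ) = Complex.exp (t * μ) * f ξ := by
  have h1 : ∀ s : ℂ, HasDerivAt (fun s => Complex.exp (-(s * μ)) * f (expFlow L s ξ)) 0 s := by
    intro s
    have hm : HasDerivAt (fun s : ℂ => -(s * μ)) (-μ) s := by
      exact ((hasDerivAt_id s).mul_const μ).neg.congr_deriv (by simp)
    have hE : HasDerivAt (fun s => f (expFlow L s ξ)) (f (L (expFlow L s ξ))) s :=
      f.hasFDerivAt.comp_hasDerivAt s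
        ((hasDerivAt_expFlow' L s).clm_apply (hasDerivAt_const s ξ) |>.congr_deriv (by simp))
    refine (hm.cexp.mul hE).congr_deriv ?_
    rw [hf]; ring
  have h2 := is_const_of_deriv_eq_zero (fun s => (h1 s).differentiableAt)
    (fun s => (h1 s).deriv) t 0
  simp only [zero_mul, neg_zero, Complex.exp_zero, expFlow_zero, one_mul,
    one_apply_eq_self] at h2
  rw [← h2, ← mul_assoc, ← Complex.exp_add, add_neg_cancel, Complex.exp_zero, one_mul]

/-- A Jordan block of size two contributes a term linear in `t`; after division by the
eigenfunctional it becomes a translation. -/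
lemma comp_expFlow_of_generalized_eigenvector (L : W →L[ℂ] W) {f g : W →L[ℂ] ℂ} {μ : ℂ}
    (hf : ∀ ξ, f (L ξ) = μ * f ξ) (hg : ∀ ξ, g (L ξ) = μ * g ξ + f ξ) (t : ℂ) (ξ : W) :
    g (expFlow L t ξ) = Complex.exp (t * μ) * (g ξ + t * f ξ) := by
  have h1 : ∀ s : ℂ, HasDerivAt
      (fun s => Complex.exp (-(s * μ)) * g (expFlow L s ξ) - s * f ξ) 0 s := by
    intro s
    have hm : HasDerivAt (fun s : ℂ => -(s * μ)) (-μ) s := by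
      exact ((hasDerivAt_id s).mul_const μ).neg.congr_deriv (by simp)
    have hE : HasDerivAt (fun s => g (expFlow L s ξ)) (g (L (expFlow L s ξ))) s :=
      g.hasFDerivAt.comp_hasDerivAt s
        ((hasDerivAt_expFlow' L s).clm_apply (hasDerivAt_const s ξ) |>.congr_deriv (by simp))
    refine ((hm.cexp.mul hE).sub ((hasDerivAt_id s).mul_const (f ξ))).congr_deriv ?_
    have h3 : Complex.exp (-(s * μ)) * Complex.exp (s * μ) = 1 := by
      rw [← Complex.exp_add, neg_add_cancel, Complex.exp_zero]
    rw [hg, comp_expFlow_of_eigenvector L hf]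
    linear_combination f ξ * h3
  have h2 := is_const_of_deriv_eq_zero (fun s => (h1 s).differentiableAt)
    (fun s => (h1 s).deriv) t 0
  simp only [zero_mul, neg_zero, Complex.exp_zero, expFlow_zero, one_mul, sub_zero,
    one_apply_eq_self] at h2
  have h3 : Complex.exp (t * μ) * Complex.exp (-(t * μ)) = 1 := by
    rw [← Complex.exp_add, add_neg_cancel, Complex.exp_zero]
  linear_combination (Complex.exp (t * μ)) * h2 - g (expFlow L t ξ) * h3

end OperatorExponential

/-! ### The map to projective space given by the sections. -/

section Evaluation

variable {n : ℕ} {X : Type*} [TopologicalSpace X] [ChartedSpace (Fin n → ℂ) X]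
  {m : ℕ}

lemma sum_section_apply {ι : Type*} (I : Finset ι) (c : ι → ℂ) (s : ι → H0 n X m)
    (e : HolChart n X) (z : Fin n → ℂ) :
    (∑ i ∈ I, c i • s i).1 e z = ∑ i ∈ I, c i * (s i).1 e z := by
  classical
  induction I using Finset.induction_on with
  | empty => rfl
  | insert i I hi ih =>
    rw [Finset.sum_insert hi, Finset.sum_insert hi, ← ih]
    rfl

variable [IsManifold 𝓘(ℂ, Fin n → ℂ) ω X] [CompactSpace X]

variable (n X m) in
/-- A basis of the space of sections. -/
def sectionBasis : Module.Basis (Fin (Nk n X m)) ℂ (H0 n X m) := Module.finBasis ℂ _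

variable (m) in
/-- The values at a point of a basis of the space of sections. -/
def evalVec (e : HolChart n X) (z : Fin n → ℂ) : Fin (Nk n X m) → ℂ :=
  fun i => (sectionBasis n X m i).1 e z

/-- The linear functional given by a section. -/
def pairing : H0 n X m →ₗ[ℂ] ((Fin (Nk n X m) → ℂ) →L[ℂ] ℂ) where
  toFun s := ∑ i, (sectionBasis n X m).repr s i • ContinuousLinearMap.proj i
  map_add' s t := by
    ext1 ξ
    simp [add_mul, Finset.sum_add_distrib]
  map_smul' c s := by
    ext1 ξ
    simp [Finset.mul_sum, mul_assoc]

lemma pairing_apply (s : H0 n X m) (ξ : Fin (Nk n X m) → ℂ) :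
    pairing s ξ = ∑ i, (sectionBasis n X m).repr s i * ξ i := by
  simp [pairing]

lemma pairing_basis (i : Fin (Nk n X m)) (ξ : Fin (Nk n X m) → ℂ) :
    pairing (sectionBasis n X m i) ξ = ξ i := by
  simp [pairing_apply, Finsupp.single_apply]

lemma pairing_evalVec (s : H0 n X m) (e : HolChart n X) (z : Fin n → ℂ) :
    pairing s (evalVec m e z) = s.1 e z := by
  rw [pairing_apply]
  conv_rhs => rw [← (sectionBasis n X m).sum_repr s]
  rw [sum_section_apply]
  rfl

/-- The transpose of an endomorphism of the space of sections. -/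
def sectionOp (A : H0 n X m →ₗ[ℂ] H0 n X m) :
    (Fin (Nk n X m) → ℂ) →L[ℂ] (Fin (Nk n X m) → ℂ) :=
  ContinuousLinearMap.pi fun i => pairing (A (sectionBasis n X m i))

lemma pairing_sectionOp (A : H0 n X m →ₗ[ℂ] H0 n X m) (s : H0 n X m)
    (ξ : Fin (Nk n X m) → ℂ) : pairing s (sectionOp A ξ) = pairing (A s) ξ := by
  conv_rhs => rw [← (sectionBasis n X m).sum_repr s, map_sum, map_sum]
  rw [pairing_apply, sum_apply]
  refine Finset.sum_congr rfl fun i _ => ?_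
  rw [map_smul, map_smul]
  rfl

/-- A change of chart rescales the evaluation vector, so its projective class depends only on the
point. -/
lemma evalVec_transition {e e' : HolChart n X} {x : X} (hx : x ∈ e.1.source)
    (hx' : x ∈ e'.1.source) :
    evalVec m e' (e'.1 x) = jacobian e e' (e.1 x) ^ m • evalVec m e (e.1 x) := by
  funext i
  exact H0.apply_eq _ hx hx'

variable (n m) in
/-- The values at a point, in the preferred chart, of a basis of the space of sections. -/
def evalAt (x : X) : Fin (Nk n X m) → ℂ := evalVec m (chartH n x) ((chartH n x).1 x)

lemma VeryAmple.evalAt_ne_zero (h : VeryAmple n X m) (x : X) : evalAt n m x ≠ 0 := by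
  intro h0
  obtain ⟨s, hs, hs0⟩ := h.1 x
  refine hs0 _ (mem_chartH_source x) ?_
  refine (pairing_evalVec ⟨s, hs⟩ _ _).symm.trans ?_
  change pairing _ (evalAt n m x) = 0
  rw [h0, map_zero]

/-- Injectivity of the projective map: a section vanishing at `x` but not at `y` excludes
proportionality. -/
lemma VeryAmple.eq_of_evalAt (h : VeryAmple n X m) {x y : X} {a : ℂ}
    (hxy : evalAt n m y = a • evalAt n m x) : y = x := by
  by_contra hne
  obtain ⟨s, hs, hs0, hs1⟩ := h.2.1 x y (Ne.symm hne)
  refine hs1 _ (mem_chartH_source y) ?_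
  refine (pairing_evalVec ⟨s, hs⟩ _ _).symm.trans ?_
  change pairing _ (evalAt n m y) = 0
  have h1 := hs0 _ (mem_chartH_source x)
  replace h1 := (pairing_evalVec ⟨s, hs⟩ _ _).trans h1
  change pairing _ (evalAt n m x) = 0 at h1
  rw [hxy, map_smul, h1, smul_zero]

/-- The point `B x` of projective space, for a linear map `B`, is the point `y` of the projectively
embedded manifold. -/
def ProjRel (B : (Fin (Nk n X m) → ℂ) →L[ℂ] (Fin (Nk n X m) → ℂ)) (x y : X) : Prop :=
  ∃ a : ℂ, evalAt n m y = a • B (evalAt n m x)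

lemma ProjRel.of_charts {B : (Fin (Nk n X m) → ℂ) →L[ℂ] (Fin (Nk n X m) → ℂ)} {x y : X}
    {e e' : HolChart n X} (hx : x ∈ e.1.source) (hy : y ∈ e'.1.source) {a : ℂ}
    (h : evalVec m e' (e'.1 y) = a • B (evalVec m e (e.1 x))) : ProjRel B x y := by
  refine ⟨jacobian e' (chartH n y) (e'.1 y) ^ m * a *
    jacobian (chartH n x) e ((chartH n x).1 x) ^ m, ?_⟩
  rw [evalAt, evalVec_transition hy (mem_chartH_source y), h,
    evalVec_transition (mem_chartH_source x) hx, map_smul, smul_smul, smul_smul]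
  rfl

lemma ProjRel.exists_charts {B : (Fin (Nk n X m) → ℂ) →L[ℂ] (Fin (Nk n X m) → ℂ)} {x y : X}
    (h : ProjRel B x y) {e e' : HolChart n X} (hx : x ∈ e.1.source) (hy : y ∈ e'.1.source) :
    ∃ a : ℂ, evalVec m e' (e'.1 y) = a • B (evalVec m e (e.1 x)) := by
  obtain ⟨a, h⟩ := h
  rw [evalAt, evalAt, evalVec_transition hx (mem_chartH_source x), map_smul] at h
  rw [evalVec_transition (mem_chartH_source y) hy, h, smul_smul, smul_smul]
  exact ⟨_, rfl⟩

end Evaluation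

/-! ### The flow of a vector field as a linear flow on projective space. -/

section Flow

variable {n : ℕ} {X : Type*} [TopologicalSpace X] [ChartedSpace (Fin n → ℂ) X]
  [IsManifold 𝓘(ℂ, Fin n → ℂ) ω X] [CompactSpace X] {m : ℕ}

/-- For small times, the flow of a holomorphic vector field is given by a linear flow on projective
space. -/
lemma VField.exists_projRel_small (V : VField n X) (c : ℂ) (x : X) :
    ∃ ε : ℝ, 0 < ε ∧ ∀ t ∈ Set.Ioo (-ε) ε,
      ∃ y, ProjRel (expFlow (sectionOp (V.lieDeriv m)) (t * c)) x y := by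
  set e := chartH n x
  have hx : x ∈ e.1.source := mem_chartH_source x
  -- The second component is a scalar factor along the integral curve. Its equation supplies the
  -- divergence term of the Lie derivative, so that factor times evaluation vector solves the linear
  -- equation `ζ' = c L ζ`.
  let F : (Fin n → ℂ) × ℂ → (Fin n → ℂ) × ℂ := fun p =>
    (c • V.coeff e p.1, -(c * m * V.div e p.1) * p.2)
  have hF : ContDiffAt ℝ 1 F (e.1 x, 1) := by
    have hV : AnalyticAt ℂ (fun p : (Fin n → ℂ) × ℂ => V.coeff e p.1) (e.1 x, 1) :=
      AnalyticAt.fun_comp (V.analyticAt' e x hx) analyticAt_fst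
    have hD : AnalyticAt ℂ (fun p : (Fin n → ℂ) × ℂ => V.div e p.1) (e.1 x, 1) :=
      AnalyticAt.fun_comp (V.analyticAt_div hx) analyticAt_fst
    have hFa : AnalyticAt ℂ F (e.1 x, 1) :=
      ((analyticAt_const (v := c)).fun_smul hV).prod
        (((analyticAt_const (v := c * m)).fun_mul hD).fun_neg.fun_mul analyticAt_snd)
    exact (hFa.contDiffAt (n := 1)).restrict_scalars ℝ
  obtain ⟨α, hα0, ε, hε, hα⟩ :=
    hF.exists_forall_mem_closedBall_exists_eq_forall_mem_Ioo_hasDerivAt₀ 0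
  have hcont : ContinuousAt (fun t => (α t).1) 0 :=
    (hα 0 (by constructor <;> linarith)).continuousAt.fst
  have hmem : ∀ᶠ t in 𝓝 (0 : ℝ), (α t).1 ∈ e.1.target := by
    refine hcont.eventually_mem (e.1.open_target.mem_nhds ?_)
    rw [hα0]
    exact e.1.map_source hx
  obtain ⟨δ, hδ, hδt⟩ := Metric.eventually_nhds_iff.1 hmem
  refine ⟨min ε δ, lt_min hε hδ, fun t ht => ?_⟩
  have hsub : ∀ s ∈ Set.Ioo (-min ε δ) (min ε δ),
      HasDerivAt α (F (α s)) s ∧ (α s).1 ∈ e.1.target := by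
    intro s hs
    have h1 : |s| < min ε δ := abs_lt.2 hs
    have h2 := abs_lt.1 (h1.trans_le (min_le_left _ _))
    refine ⟨hα s (by constructor <;> linarith [h2.1, h2.2]), hδt ?_⟩
    rw [Real.dist_eq, sub_zero]
    exact h1.trans_le (min_le_right _ _)
  let ζ : ℝ → (Fin (Nk n X m) → ℂ) := fun s => (α s).2 • evalVec m e (α s).1
  have hζ : ∀ s ∈ Set.Ioo (-min ε δ) (min ε δ),
      HasDerivAt ζ (c • sectionOp (V.lieDeriv m) (ζ s)) s := by
    intro s hs
    obtain ⟨h1, h2⟩ := hsub s hs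
    rw [hasDerivAt_pi]
    intro i
    set σ := sectionBasis n X m i with hσ
    have hfst : HasDerivAt (fun t => (α t).1) (F (α s)).1 s := h1.fst
    have hsnd : HasDerivAt (fun t => (α t).2) (F (α s)).2 s := h1.snd
    have hdσ : HasFDerivAt (σ.1 e) (fderiv ℂ (σ.1 e) (α s).1) (α s).1 :=
      (σ.2.1 e _ h2).differentiableAt.hasFDerivAt
    have h3 := hsnd.mul ((hdσ.restrictScalars ℝ).comp_hasDerivAt s hfst)
    refine h3.congr_deriv ?_
    have h4 := V.lieDeriv_apply σ (e.1.map_target h2)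
    rw [e.1.right_inv h2] at h4
    have h5 : (c • sectionOp (V.lieDeriv m) (ζ s)) i =
        c * ((α s).2 * (V.lieDeriv m σ).1 e (α s).1) := by
      change c * sectionOp (V.lieDeriv m) (ζ s) i = _
      rw [← pairing_basis i (sectionOp _ _), pairing_sectionOp, map_smul, pairing_evalVec, smul_eq_mul]
    rw [h5, h4]
    simp only [F, Function.comp, ContinuousLinearMap.coe_restrictScalars', map_smul, smul_eq_mul]
    ring
  have h0 := eq_expFlow_of_hasDerivAt _ c hζ ht
  have hζ0 : ζ 0 = evalVec m e (e.1 x) := by simp [ζ, hα0]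
  rw [hζ0] at h0
  obtain ⟨-, ht'⟩ := hsub t ht
  -- If the factor vanishes, invertibility of the exponential makes the evaluation vector at `x`
  -- zero, and the relation holds trivially with scalar `0`.
  by_cases hθ : (α t).2 = 0
  · have h1 : ζ t = 0 := by simp [ζ, hθ]
    refine ⟨x, 0, ?_⟩
    rw [zero_smul]
    have h2 := expFlow_neg_apply (sectionOp (V.lieDeriv m)) (t * c) (evalVec m e (e.1 x))
    rw [← h0, h1, map_zero] at h2
    exact h2.symm
  · refine ⟨e.1.symm (α t).1, ProjRel.of_charts hx (e.1.map_target ht') (a := (α t).2⁻¹) ?_⟩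
    rw [← h0, e.1.right_inv ht', inv_smul_smul₀ hθ]

lemma exists_eq_smul_iff_minors {ι : Type*} {ξ η : ι → ℂ} (hξ : ξ ≠ 0) :
    (∃ a : ℂ, η = a • ξ) ↔ ∀ i j, η i * ξ j = η j * ξ i := by
  constructor
  · rintro ⟨a, rfl⟩ i j
    simp only [Pi.smul_apply, smul_eq_mul]
    ring
  · intro h
    obtain ⟨j, hj⟩ := Function.ne_iff.1 hξ
    refine ⟨η j / ξ j, funext fun i => ?_⟩
    rw [Pi.smul_apply, smul_eq_mul, div_mul_eq_mul_div, eq_div_iff hj]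
    exact h i j

lemma VeryAmple.evalVec_ne_zero (h : VeryAmple n X m) {e : HolChart n X} {x : X}
    (hx : x ∈ e.1.source) : evalVec m e (e.1 x) ≠ 0 := fun h0 => by
  refine h.evalAt_ne_zero x ?_
  rw [evalAt, evalVec_transition hx (mem_chartH_source x), h0, smul_zero]

/-- Since the flowed evaluation vector is non-zero, proportionality means that all `2 × 2` minors
vanish, a closed condition in charts. -/
lemma VeryAmple.isClosed_projRel (h : VeryAmple n X m)
    (L : (Fin (Nk n X m) → ℂ) →L[ℂ] (Fin (Nk n X m) → ℂ)) :
    IsClosed {p : ℂ × X × X | ProjRel (expFlow L p.1) p.2.1 p.2.2} := by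
  rw [← isOpen_compl_iff, isOpen_iff_mem_nhds]
  rintro ⟨t, x, y⟩ hp
  set e := chartH n x
  set e' := chartH n y
  have hx : x ∈ e.1.source := mem_chartH_source x
  have hy : y ∈ e'.1.source := mem_chartH_source y
  have key : ∀ q : ℂ × X × X, q.2.1 ∈ e.1.source → q.2.2 ∈ e'.1.source →
      (ProjRel (expFlow L q.1) q.2.1 q.2.2 ↔ ∀ i j, evalVec m e' (e'.1 q.2.2) i *
        expFlow L q.1 (evalVec m e (e.1 q.2.1)) j = evalVec m e' (e'.1 q.2.2) j *
          expFlow L q.1 (evalVec m e (e.1 q.2.1)) i) := by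
    intro q hq hq'
    rw [← exists_eq_smul_iff_minors (expFlow_apply_ne_zero L _ (h.evalVec_ne_zero hq))]
    exact ⟨fun hr => hr.exists_charts hq hq', fun ⟨a, ha⟩ => ProjRel.of_charts hq hq' ha⟩
  have hn : ¬ ProjRel (expFlow L t) x y := hp
  rw [key (t, x, y) hx hy] at hn
  push Not at hn
  obtain ⟨i, j, hij⟩ := hn
  have hcx : ContinuousAt (fun q : ℂ × X × X => evalVec m e (e.1 q.2.1)) (t, x, y) := by
    have : ContinuousAt (fun x => evalVec m e (e.1 x)) x := continuousAt_pi.2 fun i =>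
      (H0.continuousOn_chart _ e).continuousAt (e.1.open_source.mem_nhds hx)
    exact ContinuousAt.comp (x := (t, x, y)) (f := fun q : ℂ × X × X => q.2.1) this (by fun_prop)
  have hcy : ContinuousAt (fun q : ℂ × X × X => evalVec m e' (e'.1 q.2.2)) (t, x, y) := by
    have : ContinuousAt (fun x => evalVec m e' (e'.1 x)) y := continuousAt_pi.2 fun i =>
      (H0.continuousOn_chart _ e').continuousAt (e'.1.open_source.mem_nhds hy)
    exact ContinuousAt.comp (x := (t, x, y)) (f := fun q : ℂ × X × X => q.2.2) this (by fun_prop)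
  have hcE : ContinuousAt (fun q : ℂ × X × X => expFlow L q.1 (evalVec m e (e.1 q.2.1)))
      (t, x, y) :=
    ((continuous_expFlow L).comp continuous_fst).continuousAt.clm_apply hcx
  have hne := (((continuousAt_pi.1 hcy i).mul (continuousAt_pi.1 hcE j)).sub
    ((continuousAt_pi.1 hcy j).mul (continuousAt_pi.1 hcE i))).eventually_ne (sub_ne_zero.2 hij)
  have hox : ∀ᶠ q : ℂ × X × X in 𝓝 (t, x, y), q.2.1 ∈ e.1.source :=
    (by fun_prop : Continuous fun q : ℂ × X × X => q.2.1).continuousAt.eventually_mem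
      (e.1.open_source.mem_nhds hx)
  have hoy : ∀ᶠ q : ℂ × X × X in 𝓝 (t, x, y), q.2.2 ∈ e'.1.source :=
    (by fun_prop : Continuous fun q : ℂ × X × X => q.2.2).continuousAt.eventually_mem
      (e'.1.open_source.mem_nhds hy)
  filter_upwards [hne, hox, hoy] with q h1 h2 h3 h4
  exact sub_ne_zero.1 h1 ((key q h2 h3).1 h4 i j)

lemma VField.exists_projRel (V : VField n X) (h : VeryAmple n X m) (c : ℂ) (x : X) :
    ∃ y, ProjRel (expFlow (sectionOp (V.lieDeriv m)) c) x y := by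
  set L := sectionOp (V.lieDeriv m)
  -- The times at which the linear flow keeps `x` in `X`: closed because `X` is compact, open by the
  -- small-time flow at the endpoint, hence all of `ℝ`.
  let T : Set ℝ := {t | ∃ y, ProjRel (expFlow L (t * c)) x y}
  have hclosed : IsClosed T := by
    have h1 : IsClosed {p : ℝ × X | ProjRel (expFlow L (p.1 * c)) x p.2} :=
      (h.isClosed_projRel L).preimage
        (by fun_prop : Continuous fun p : ℝ × X => ((p.1 : ℂ) * c, x, p.2))
    have h2 := isClosedMap_fst_of_compactSpace _ h1
    convert h2 using 1
    ext t
    simp [T]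
  have hopen : IsOpen T := by
    rw [Metric.isOpen_iff]
    rintro t ⟨y, a, hy⟩
    obtain ⟨ε, hε, hs⟩ := V.exists_projRel_small (m := m) c y
    refine ⟨ε, hε, fun s hs' => ?_⟩
    rw [Metric.mem_ball, Real.dist_eq] at hs'
    obtain ⟨z, b, hz⟩ := hs (s - t) (abs_lt.1 hs')
    refine ⟨z, b * a, ?_⟩
    rw [hz, hy, map_smul, smul_smul, ← expFlow_apply_add]
    congr 3
    push_cast
    ring
  have huniv : T = Set.univ := IsClopen.eq_univ ⟨hclosed, hopen⟩
    ⟨0, x, 1, by simp [expFlow_zero]⟩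
  have h1 : (1 : ℝ) ∈ T := huniv ▸ Set.mem_univ _
  simpa [T] using h1

/-- The time-`c` flow of a holomorphic vector field, as a homeomorphism. -/
lemma VField.exists_homeomorph (V : VField n X) (h : VeryAmple n X m) (c : ℂ) :
    ∃ φ : X ≃ₜ X, (∀ x, ProjRel (expFlow (sectionOp (V.lieDeriv m)) c) x (φ x)) ∧
      ∀ x, ProjRel (expFlow (sectionOp (V.lieDeriv m)) (-c)) x (φ.symm x) := by
  set L := sectionOp (V.lieDeriv m)
  choose φ hφ using V.exists_projRel h
  have hinv : ∀ c x, φ (-c) (φ c x) = x := by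
    intro c x
    obtain ⟨a, ha⟩ := hφ c x
    obtain ⟨b, hb⟩ := hφ (-c) (φ c x)
    refine h.eq_of_evalAt (a := b * a) ?_
    rw [hb, ha, map_smul, smul_smul, expFlow_neg_apply]
  -- Closed graph argument: the preimage of a closed set is the projection of a closed subset of `X
  -- × X` along a compact factor.
  have hcont : ∀ c, Continuous (φ c) := by
    intro c
    rw [continuous_iff_isClosed]
    intro C hC
    have h1 : IsClosed {p : X × X | ProjRel (expFlow L c) p.1 p.2 ∧ p.2 ∈ C} :=
      ((h.isClosed_projRel L).preimage
        (by fun_prop : Continuous fun p : X × X => (c, p.1, p.2))).inter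
        (hC.preimage continuous_snd)
    have h2 := isClosedMap_fst_of_compactSpace _ h1
    convert h2 using 1
    ext x
    simp only [Set.mem_preimage, Set.mem_image, Set.mem_ofPred_eq, Prod.exists, exists_and_right,
      exists_eq_right]
    constructor
    · exact fun hx => ⟨φ c x, hφ c x, hx⟩
    · rintro ⟨y, ⟨b, hb⟩, hyC⟩
      obtain ⟨a, ha⟩ := hφ c x
      have hb0 : b ≠ 0 := by
        rintro rfl
        exact h.evalAt_ne_zero y (by rw [hb, zero_smul])
      have : φ c x = y := h.eq_of_evalAt (a := a * b⁻¹) (by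
        rw [ha, hb, smul_smul, mul_assoc, inv_mul_cancel₀ hb0, mul_one])
      rwa [this]
  refine ⟨⟨⟨φ c, φ (-c), hinv c, fun x => ?_⟩, hcont c, hcont (-c)⟩, hφ c, hφ (-c)⟩
  have := hinv (-c) x
  rwa [neg_neg] at this

end Flow

/-! ### Holomorphy of the flow, and its action on ratios of eigensections. -/

section Biholomorphism

variable {n : ℕ} {X : Type*} [TopologicalSpace X] [ChartedSpace (Fin n → ℂ) X]
  [IsManifold 𝓘(ℂ, Fin n → ℂ) ω X] [CompactSpace X] {m : ℕ}

lemma ProjRel.exists_ne_zero {B : (Fin (Nk n X m) → ℂ) →L[ℂ] (Fin (Nk n X m) → ℂ)} {x y : X}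
    (hB : ProjRel B x y) (h : VeryAmple n X m) :
    ∃ a : ℂ, a ≠ 0 ∧ ∀ s : H0 n X m, pairing s (evalAt n m y) = a * pairing s (B (evalAt n m x)) := by
  obtain ⟨a, ha⟩ := hB
  refine ⟨a, ?_, fun s => by rw [ha, map_smul, smul_eq_mul]⟩
  rintro rfl
  exact h.evalAt_ne_zero y (by rw [ha, zero_smul])

lemma mem_support_iff_pairing {s : H0 n X m} {x : X} :
    x ∈ H0.support s ↔ pairing s (evalAt n m x) ≠ 0 := by
  rw [H0.mem_support_iff (mem_chartH_source x), evalAt, pairing_evalVec]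

lemma ratio_eq_pairing (s t : H0 n X m) (x : X) :
    H0.ratio s t x = pairing s (evalAt n m x) / pairing t (evalAt n m x) := by
  rw [evalAt, pairing_evalVec, pairing_evalVec]
  rfl

lemma ProjRel.ratio_eq {B : (Fin (Nk n X m) → ℂ) →L[ℂ] (Fin (Nk n X m) → ℂ)} {x y : X}
    (hB : ProjRel B x y) (h : VeryAmple n X m) (s t : H0 n X m) :
    H0.ratio s t y = pairing s (B (evalAt n m x)) / pairing t (B (evalAt n m x)) := by
  obtain ⟨a, ha, hs⟩ := hB.exists_ne_zero h
  rw [ratio_eq_pairing, hs, hs, mul_div_mul_left _ _ ha]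

/-- A continuous self-map of a projectively embedded manifold which is induced by a linear map is
holomorphic. -/
lemma contMDiff_of_projRel (h : VeryAmple n X m)
    {B : (Fin (Nk n X m) → ℂ) →L[ℂ] (Fin (Nk n X m) → ℂ)} {φ : X → X} (hφ : Continuous φ)
    (hB : ∀ x, ProjRel B x (φ x)) : ContMDiff 𝓘(ℂ, Fin n → ℂ) 𝓘(ℂ, Fin n → ℂ) ω φ := by
  intro x
  rw [contMDiffAt_iff]
  refine ⟨hφ.continuousAt, ?_⟩
  suffices hA : AnalyticAt ℂ (fun z => (chartH n (φ x)).1 (φ ((chartH n x).1.symm z)))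
      ((chartH n x).1 x) from hA.contDiffAt.contDiffWithinAt
  set e := chartH n x
  set e' := chartH n (φ x)
  have hx : x ∈ e.1.source := mem_chartH_source x
  have hy : φ x ∈ e'.1.source := mem_chartH_source (φ x)
  set w₀ := e'.1 (φ x) with hw₀
  obtain ⟨s₀', hs₀', hs₀''⟩ := h.1 (φ x)
  set s₀ : H0 n X m := ⟨s₀', hs₀'⟩
  have hs₀ : s₀.1 e' w₀ ≠ 0 := hs₀'' e' hy
  -- With these differentials the ratios `σ i / s₀` have derivative the identity at `φ x`, so they
  -- are local coordinates there.
  choose σ hσ hσ' using fun i : Fin n => h.exists_fderiv_eq hy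
    (s₀.1 e' w₀ • (ContinuousLinearMap.proj i : (Fin n → ℂ) →L[ℂ] ℂ))
  let F : (Fin n → ℂ) → (Fin n → ℂ) := fun w i => (σ i).1 e' w / s₀.1 e' w
  have hFa : AnalyticAt ℂ F w₀ := by
    rw [analyticAt_pi_iff]
    exact fun i => (H0.analyticAt (σ i) hy).fun_div (H0.analyticAt s₀ hy) hs₀
  have hFd : HasFDerivAt F
      ((ContinuousLinearEquiv.refl ℂ (Fin n → ℂ) : (Fin n → ℂ) →L[ℂ] (Fin n → ℂ))) w₀ := by
    rw [hasFDerivAt_pi']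
    intro i
    have h1 := (H0.differentiableAt (σ i) hy).hasFDerivAt.mul
      ((hasDerivAt_inv hs₀).comp_hasFDerivAt w₀ (H0.differentiableAt s₀ hy).hasFDerivAt)
    refine (h1.congr_fderiv ?_)
    rw [← hw₀, hσ, hσ']
    ext u
    simp [hs₀]
  have hFc : ContDiffAt ℂ ω F w₀ := hFa.contDiffAt
  have hω : (ω : WithTop ℕ∞) ≠ 0 := by simp
  have hG : AnalyticAt ℂ (hFc.localInverse hFd hω) (F w₀) := (hFc.to_localInverse hFd hω).analyticAt
  have hGF : ∀ᶠ w in 𝓝 w₀, hFc.localInverse hFd hω (F w) = w :=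
    (hFc.hasStrictFDerivAt' hFd hω).eventually_left_inverse
  -- The same ratios at `φ x'`, computed through the linear map `B`; they are visibly analytic in
  -- the source. Then `F ∘ φ = Q`, and locally `φ` is the inverse of `F` applied to `Q`.
  let Q : (Fin n → ℂ) → (Fin n → ℂ) := fun z i =>
    pairing (σ i) (B (evalVec m e z)) / pairing s₀ (B (evalVec m e z))
  have hratio : ∀ x', x' ∈ e.1.source → φ x' ∈ e'.1.source → F (e'.1 (φ x')) = Q (e.1 x') := by
    intro x' hx' hy'
    funext i
    change (σ i).1 e' (e'.1 (φ x')) / s₀.1 e' (e'.1 (φ x')) = _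
    rw [← H0.ratio_eq _ _ hy', (hB x').ratio_eq h, evalAt,
      evalVec_transition hx' (mem_chartH_source x'), map_smul, map_smul, map_smul, smul_eq_mul,
      smul_eq_mul, mul_div_mul_left _ _ (pow_ne_zero _ (jacobian_ne_zero hx' (mem_chartH_source x')))]
  have hs₀B : pairing s₀ (B (evalVec m e (e.1 x))) ≠ 0 := by
    obtain ⟨a, ha, hs⟩ := (hB x).exists_ne_zero h
    have h1 : pairing s₀ (evalAt n m (φ x)) ≠ 0 := by
      rw [evalAt, pairing_evalVec]; exact hs₀
    rw [hs] at h1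
    exact right_ne_zero_of_mul h1
  have hev : AnalyticAt ℂ (evalVec m e) (e.1 x) :=
    analyticAt_pi_iff.2 fun i => H0.analyticAt _ hx
  have hQ : AnalyticAt ℂ Q (e.1 x) := by
    rw [analyticAt_pi_iff]
    have hp : ∀ s : H0 n X m, AnalyticAt ℂ (fun z => pairing s (B (evalVec m e z))) (e.1 x) :=
      fun s => ((pairing s).comp B).analyticAt _ |>.fun_comp hev
    exact fun i => (hp (σ i)).fun_div (hp s₀) hs₀B
  have hcomp : AnalyticAt ℂ (fun z => hFc.localInverse hFd hω (Q z)) (e.1 x) := by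
    refine AnalyticAt.fun_comp ?_ hQ
    rw [← hratio x hx hy]
    exact hG
  refine hcomp.congr ?_
  -- Continuity of `φ` keeps nearby images where the local inverse of `F` is valid.
  have hc : ContinuousAt (fun z => φ (e.1.symm z)) (e.1 x) :=
    hφ.continuousAt.comp (e.1.continuousAt_symm (e.1.map_source hx))
  have hφx : φ (e.1.symm (e.1 x)) = φ x := by rw [e.1.left_inv hx]
  have h1 : ∀ᶠ z in 𝓝 (e.1 x), φ (e.1.symm z) ∈ e'.1.source :=
    hc.eventually_mem (e'.1.open_source.mem_nhds (by rwa [hφx]))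
  have h2 : ∀ᶠ z in 𝓝 (e.1 x),
      hFc.localInverse hFd hω (F (e'.1 (φ (e.1.symm z)))) = e'.1 (φ (e.1.symm z)) := by
    refine Tendsto.eventually (f := fun z => e'.1 (φ (e.1.symm z))) ?_ hGF
    have h3 : ContinuousAt e'.1 (φ (e.1.symm (e.1 x))) := by
      rw [hφx]; exact e'.1.continuousAt hy
    have h4 := ContinuousAt.comp (f := fun z => φ (e.1.symm z)) h3 hc
    rw [ContinuousAt, Function.comp_apply, hφx] at h4
    exact h4
  filter_upwards [h1, h2, e.1.open_target.mem_nhds (e.1.map_source hx)] with z hz1 hz2 hz3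
  rw [← hz2, hratio _ (e.1.map_target hz3) hz1, e.1.right_inv hz3]

/-- The time-`c` flow of a holomorphic vector field, as a biholomorphic map. -/
lemma VField.exists_diffeomorph (V : VField n X) (h : VeryAmple n X m) (c : ℂ) :
    ∃ φ : Diffeomorph 𝓘(ℂ, Fin n → ℂ) 𝓘(ℂ, Fin n → ℂ) X X ω,
      ∀ x, ProjRel (expFlow (sectionOp (V.lieDeriv m)) c) x (φ x) := by
  obtain ⟨φ, hφ, hφ'⟩ := V.exists_homeomorph h c
  exact ⟨⟨φ.toEquiv, contMDiff_of_projRel h φ.continuous hφ,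
    contMDiff_of_projRel h φ.symm.continuous hφ'⟩, hφ⟩

section Eigensections

variable {V : VField n X} {c : ℂ} {φ : X → X}

lemma map_mem_support_iff
    (hφ : ∀ x, ProjRel (expFlow (sectionOp (V.lieDeriv m)) c) x (φ x)) (h : VeryAmple n X m)
    {s : H0 n X m} {μ : ℂ} (hs : V.lieDeriv m s = μ • s) (x : X) :
    φ x ∈ H0.support s ↔ x ∈ H0.support s := by
  obtain ⟨a, ha, hax⟩ := (hφ x).exists_ne_zero h
  rw [mem_support_iff_pairing, mem_support_iff_pairing, hax,
    comp_expFlow_of_eigenvector (f := pairing s) (μ := μ)]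
  · simp [ha, Complex.exp_ne_zero]
  · intro ξ
    rw [pairing_sectionOp, hs, map_smul, smul_apply, smul_eq_mul]

lemma ratio_map_of_eigensections
    (hφ : ∀ x, ProjRel (expFlow (sectionOp (V.lieDeriv m)) c) x (φ x)) (h : VeryAmple n X m)
    {s t : H0 n X m} {μ ν : ℂ} (hs : V.lieDeriv m s = μ • s)
    (ht : V.lieDeriv m t = ν • t) (x : X) :
    H0.ratio s t (φ x) = Complex.exp (c * (μ - ν)) * H0.ratio s t x := by
  rw [(hφ x).ratio_eq h, ratio_eq_pairing, comp_expFlow_of_eigenvector (f := pairing s) (μ := μ),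
    comp_expFlow_of_eigenvector (f := pairing t) (μ := ν), mul_sub, Complex.exp_sub,
    mul_div_mul_comm]
  · intro ξ
    rw [pairing_sectionOp, ht, map_smul, smul_apply, smul_eq_mul]
  · intro ξ
    rw [pairing_sectionOp, hs, map_smul, smul_apply, smul_eq_mul]

lemma ratio_map_of_generalized_eigensection
    (hφ : ∀ x, ProjRel (expFlow (sectionOp (V.lieDeriv m)) c) x (φ x)) (h : VeryAmple n X m)
    {s t : H0 n X m} {μ : ℂ}
    (hs : V.lieDeriv m s = μ • s + t) (ht : V.lieDeriv m t = μ • t) {x : X}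
    (hx : x ∈ H0.support t) : H0.ratio s t (φ x) = H0.ratio s t x + c := by
  have ht' : ∀ ξ, pairing t (sectionOp (V.lieDeriv m) ξ) = μ * pairing t ξ := fun ξ => by
    rw [pairing_sectionOp, ht, map_smul, smul_apply, smul_eq_mul]
  have hs' : ∀ ξ, pairing s (sectionOp (V.lieDeriv m) ξ) = μ * pairing s ξ + pairing t ξ :=
    fun ξ => by rw [pairing_sectionOp, hs, map_add, map_smul, add_apply, smul_apply, smul_eq_mul]
  rw [mem_support_iff_pairing] at hx
  rw [(hφ x).ratio_eq h, ratio_eq_pairing, comp_expFlow_of_generalized_eigenvector _ ht' hs',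
    comp_expFlow_of_eigenvector _ ht', mul_div_mul_left _ _ (Complex.exp_ne_zero _), add_div,
    mul_div_cancel_right₀ _ hx]

end Eigensections

end Biholomorphism

/-! ### The identity theorem for sections. -/

section IdentityTheorem

variable {n : ℕ} {X : Type*} [TopologicalSpace X] [ChartedSpace (Fin n → ℂ) X]
  [IsManifold 𝓘(ℂ, Fin n → ℂ) ω X] [ConnectedSpace X]

/-- A non-zero section on a connected manifold does not vanish identically on an open set. -/
lemma H0.dense_support {k : ℕ} {s : H0 n X k} (hs : s ≠ 0) : Dense (H0.support s) := by
  -- The interior of the zero locus. It is closed by the identity theorem on coordinate balls, so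
  -- connectedness leaves only `∅` and `X`.
  let Z : Set X := {x | ∀ᶠ y in 𝓝 x, y ∉ H0.support s}
  have hopen : IsOpen Z := isOpen_iff_mem_nhds.2 fun x hx => eventually_eventually_nhds.2 hx
  have hclosed : IsClosed Z := by
    refine isClosed_of_closure_subset fun x hx => ?_
    set e := chartH n x
    have hxe : x ∈ e.1.source := mem_chartH_source x
    obtain ⟨r, hr, hB⟩ := Metric.mem_nhds_iff.1 (e.1.open_target.mem_nhds (e.1.map_source hxe))
    have hO : e.1.source ∩ e.1 ⁻¹' Metric.ball (e.1 x) r ∈ 𝓝 x :=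
      (e.1.isOpen_inter_preimage Metric.isOpen_ball).mem_nhds ⟨hxe, Metric.mem_ball_self hr⟩
    obtain ⟨y, ⟨hye, hyB⟩, hyZ⟩ := mem_closure_iff_nhds.1 hx _ hO
    have h0 : s.1 e =ᶠ[𝓝 (e.1 y)] 0 := by
      have h1 : ∀ᶠ z in 𝓝 (e.1 y), e.1.symm z ∉ H0.support s := by
        refine Tendsto.eventually (p := fun w => w ∉ H0.support s)
          (e.1.continuousAt_symm (e.1.map_source hye)) ?_
        rw [e.1.left_inv hye]
        exact hyZ
      filter_upwards [h1, e.1.open_target.mem_nhds (e.1.map_source hye)] with z hz hzt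
      rw [H0.mem_support_iff (e.1.map_target hzt), e.1.right_inv hzt, not_not] at hz
      exact hz
    have h2 := ((s.2.1 e).mono hB).eqOn_zero_of_preconnected_of_eventuallyEq_zero
      (convex_ball _ _).isPreconnected hyB h0
    filter_upwards [hO] with w hw
    rw [H0.mem_support_iff hw.1, not_not]
    exact h2 hw.2
  rcases isClopen_iff.1 ⟨hclosed, hopen⟩ with h | h
  · intro x
    have hx : x ∉ Z := h ▸ Set.notMem_empty x
    rw [mem_closure_iff_frequently]
    intro hc
    exact hx hc
  · refine absurd (H0.ext_charts fun e x hx => ?_) hs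
    have : x ∈ Z := h ▸ Set.mem_univ x
    have h1 := this.self_of_nhds
    rw [H0.mem_support_iff hx, not_not] at h1
    exact h1

lemma H0.nonempty_support_inter {k : ℕ} {s t : H0 n X k} (hs : s ≠ 0) (ht : t ≠ 0) :
    (H0.support s ∩ H0.support t).Nonempty := by
  have := (H0.dense_support ht).nonempty
  rw [Set.inter_comm]
  exact (H0.dense_support hs).inter_open_nonempty _ (H0.isOpen_support t) this

end IdentityTheorem

/-! ### Poincaré recurrence against translations. -/

section Recurrence

/-- A measure preserving map of a finite measure space cannot act by a non-zero translation on the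
values of a real function. -/
lemma measure_eq_zero_of_translation {Y : Type*} [MeasurableSpace Y] {ν : Measure Y}
    [IsFiniteMeasure ν] {φ : Y → Y} (hφ : MeasurePreserving φ ν ν) {U : Set Y}
    (hU : MeasurableSet U) (hφU : ∀ y ∈ U, φ y ∈ U) {f : Y → ℝ} (hf : Measurable f) {d : ℝ}
    (hd : d ≠ 0) (hfφ : ∀ y ∈ U, f (φ y) = f y + d) : ν U = 0 := by
  have hit : ∀ (j : ℕ) (y : Y), y ∈ U → φ^[j] y ∈ U ∧ f (φ^[j] y) = f y + j * d := by
    intro j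
    induction j with
    | zero => intro y hy; simpa using hy
    | succ j ih =>
      intro y hy
      obtain ⟨h1, h2⟩ := ih y hy
      rw [Function.iterate_succ_apply']
      refine ⟨hφU _ h1, ?_⟩
      rw [hfφ _ h1, h2]
      push_cast
      ring
  -- Each application of `φ` raises `f / d` by exactly one, whatever the sign of `d`, so no point of
  -- a slice returns to it; recurrence makes every slice null.
  let S : ℤ → Set Y := fun i => {y ∈ U | ⌊f y / d⌋ = i}
  have hS : ∀ i, ν (S i) = 0 := by
    intro i
    by_contra hne
    have hm : MeasurableSet (S i) :=
      hU.inter (((hf.div_const d).floor) (measurableSet_singleton i))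
    obtain ⟨y, hy, j, hj, hy'⟩ := hφ.conservative.exists_mem_iterate_mem hm.nullMeasurableSet hne
    have h1 := (hit j y hy.1).2
    have h2 := hy'.2
    rw [h1, add_div, mul_div_cancel_right₀ _ hd, Int.floor_add_natCast, hy.2] at h2
    omega
  have hUS : U ⊆ ⋃ i, S i := fun y hy => Set.mem_iUnion.2 ⟨_, hy, rfl⟩
  exact measure_mono_null hUS (measure_iUnion_null hS)

end Recurrence

/-! ### Measurability of the local expressions. -/

section Measurability

variable {n : ℕ} {X : Type*} [TopologicalSpace X] [ChartedSpace (Fin n → ℂ) X]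

lemma isOpen_prodTarget {N : ℕ} (e : Fin N → HolChart n X) : IsOpen (prodTarget e) := by
  have : prodTarget e = ⋂ j, (fun z : Fin N → Fin n → ℂ => z j) ⁻¹' (e j).1.target := by
    ext z; simp [prodTarget]
  rw [this]
  exact isOpen_iInter_of_finite fun j => (e j).1.open_target.preimage (continuous_apply j)

lemma measurable_section {k : ℕ} (s : H0 n X k) (e : HolChart n X) : Measurable (s.1 e) := by
  classical
  have h : s.1 e = e.1.target.piecewise (s.1 e) (fun _ => 0) := by
    funext z
    by_cases hz : z ∈ e.1.target
    · simp [hz]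
    · simp [hz, s.2.2.1 e z hz]
  rw [h]
  exact (s.2.1 e).continuousOn.measurable_piecewise continuousOn_const
    e.1.open_target.measurableSet

lemma measurable_detS {k : ℕ} (b : Module.Basis (Fin (Nk n X k)) ℂ (H0 n X k))
    (e : Fin (Nk n X k) → HolChart n X) : Measurable (detS b e) := by
  unfold detS
  simp only [Matrix.det_apply, Matrix.of_apply]
  refine Finset.measurable_sum _ fun σ _ => ?_
  refine Measurable.const_smul ?_ _
  exact Finset.measurable_prod _ fun j _ =>
    (measurable_section (b (σ j)) (e j)).comp (measurable_pi_apply j)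

lemma measurable_localDensity {k : ℕ} (b : Module.Basis (Fin (Nk n X k)) ℂ (H0 n X k)) (t : ℝ)
    (e : Fin (Nk n X k) → HolChart n X) : Measurable (localDensity b t e) :=
  (measurable_detS b e).enorm.pow_const _

lemma aemeasurable_prodSymm [MeasurableSpace X] [BorelSpace X] {N : ℕ}
    (e : Fin N → HolChart n X) :
    AEMeasurable (fun z j => (e j).1.symm (z j)) (volume.restrict (prodTarget e)) := by
  refine aemeasurable_pi_lambda _ fun j => ?_
  refine ContinuousOn.aemeasurable ?_ (isOpen_prodTarget e).measurableSet
  exact (e j).1.continuousOn_symm.comp (continuous_apply j).continuousOn fun z hz => hz j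

lemma aemeasurable_prodSymm_withDensity [MeasurableSpace X] [BorelSpace X] {k : ℕ}
    (b : Module.Basis (Fin (Nk n X k)) ℂ (H0 n X k)) (e : Fin (Nk n X k) → HolChart n X) :
    AEMeasurable (fun z j => (e j).1.symm (z j))
      ((volume.restrict (prodTarget e)).withDensity (localDensity b 1 e)) :=
  (aemeasurable_prodSymm e).mono_ac (withDensity_absolutelyContinuous _ _)

lemma localMeasure_le_canonicalMeasure [MeasurableSpace X] {k : ℕ}
    (b : Module.Basis (Fin (Nk n X k)) ℂ (H0 n X k)) (e : Fin (Nk n X k) → HolChart n X) :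
    localMeasure b e ≤ canonicalMeasure b := le_iSup (fun e => localMeasure b e) e

lemma measurable_diagonal_map (φ : Diffeomorph 𝓘(ℂ, Fin n → ℂ) 𝓘(ℂ, Fin n → ℂ) X X ω) (N : ℕ)
    [MeasurableSpace X] [BorelSpace X] :
    Measurable fun (x : Fin N → X) j => φ (x j) :=
  measurable_pi_lambda _ fun j => φ.continuous.measurable.comp (measurable_pi_apply j)

end Measurability

/-! ### Biholomorphisms acting on charts, sections and the canonical measure. -/

section Transport

variable {n : ℕ} {X : Type*} [TopologicalSpace X] [ChartedSpace (Fin n → ℂ) X]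
  [IsManifold 𝓘(ℂ, Fin n → ℂ) ω X]

/-- The image of a chart under a biholomorphic map. -/
def moveChart (φ : Diffeomorph 𝓘(ℂ, Fin n → ℂ) 𝓘(ℂ, Fin n → ℂ) X X ω) (e : HolChart n X) :
    HolChart n X :=
  ⟨φ.symm.toHomeomorph.transOpenPartialHomeomorph e.1, by
    rw [IsManifold.mem_maximalAtlas_iff_contMDiffOn]
    obtain ⟨h1, h2⟩ := (IsManifold.mem_maximalAtlas_iff_contMDiffOn e.1).1 e.2
    exact ⟨h1.comp φ.symm.contMDiff.contMDiffOn fun x hx => hx, φ.contMDiff.comp_contMDiffOn h2⟩⟩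

section

variable (φ : Diffeomorph 𝓘(ℂ, Fin n → ℂ) 𝓘(ℂ, Fin n → ℂ) X X ω)

lemma moveChart_apply (e : HolChart n X) (x : X) : (moveChart φ e).1 (φ x) = e.1 x :=
  congrArg e.1 (φ.symm_apply_apply x)

lemma mem_moveChart_source {e : HolChart n X} {x : X} :
    φ x ∈ (moveChart φ e).1.source ↔ x ∈ e.1.source := by
  change φ.symm (φ x) ∈ e.1.source ↔ _
  rw [φ.symm_apply_apply]

lemma moveChart_symm_moveChart (e : HolChart n X) : moveChart φ (moveChart φ.symm e) = e := by
  apply Subtype.ext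
  refine OpenPartialHomeomorph.ext _ _ (fun x => ?_) (fun z => ?_) ?_
  · exact congrArg e.1 (φ.apply_symm_apply x)
  · exact φ.apply_symm_apply _
  · ext x
    change φ (φ.symm x) ∈ e.1.source ↔ _
    rw [φ.apply_symm_apply]

lemma jacobian_moveChart (e e' : HolChart n X) (z : Fin n → ℂ) :
    jacobian (moveChart φ e) (moveChart φ e') z = jacobian e e' z := by
  have : transition (moveChart φ e) (moveChart φ e') = transition e e' := by
    funext w
    exact moveChart_apply φ e' _
  rw [jacobian_eq, jacobian_eq, this]

/-- The pull-back of sections under a biholomorphic map. -/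
def pullback (k : ℕ) : H0 n X k →ₗ[ℂ] H0 n X k where
  toFun s := ⟨fun e => s.1 (moveChart φ e), fun e => s.2.1 (moveChart φ e),
    fun e z hz => s.2.2.1 (moveChart φ e) z hz, fun e e' x hx hx' => by
      have h := s.2.2.2 (moveChart φ e) (moveChart φ e') (φ x) ((mem_moveChart_source φ).2 hx)
        ((mem_moveChart_source φ).2 hx')
      rwa [moveChart_apply, moveChart_apply, jacobian_moveChart] at h⟩
  map_add' _ _ := rfl
  map_smul' _ _ := rfl

lemma pullback_symm_comp (k : ℕ) : pullback φ.symm k ∘ₗ pullback φ k = LinearMap.id := by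
  apply LinearMap.ext
  intro s
  apply Subtype.ext
  funext e
  change s.1 (moveChart φ (moveChart φ.symm e)) = s.1 e
  rw [moveChart_symm_moveChart]

lemma det_pullback_symm_mul (k : ℕ) :
    LinearMap.det (pullback φ.symm (X := X) k) * LinearMap.det (pullback φ k) = 1 := by
  rw [← LinearMap.det_comp, pullback_symm_comp, LinearMap.det_id]

/-- Evaluating in moved charts is evaluating the pulled-back basis, so the matrix is multiplied by
that of `pullback`. -/
lemma detS_moveChart {k : ℕ} (b : Module.Basis (Fin (Nk n X k)) ℂ (H0 n X k))
    (e : Fin (Nk n X k) → HolChart n X) (z : Fin (Nk n X k) → Fin n → ℂ) :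
    detS b (fun j => moveChart φ (e j)) z = LinearMap.det (pullback φ k) * detS b e z := by
  rw [← LinearMap.det_toMatrix b, detS, detS, ← Matrix.det_transpose (LinearMap.toMatrix b b _),
    ← Matrix.det_mul]
  congr 1
  ext i j
  rw [Matrix.mul_apply]
  simp only [Matrix.of_apply, Matrix.transpose_apply, LinearMap.toMatrix_apply]
  have h : (b i).1 (moveChart φ (e j)) (z j) = (pullback φ k (b i)).1 (e j) (z j) := rfl
  rw [h]
  conv_lhs => rw [← b.sum_repr (pullback φ k (b i))]
  exact sum_section_apply _ _ _ _ _

lemma localDensity_moveChart {k : ℕ} (b : Module.Basis (Fin (Nk n X k)) ℂ (H0 n X k)) (t : ℝ)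
    (e : Fin (Nk n X k) → HolChart n X) :
    localDensity b t (fun j => moveChart φ (e j)) =
      (‖LinearMap.det (pullback φ (X := X) k)‖ₑ ^ (-(2 * t / k) : ℝ)) • localDensity b t e := by
  funext z
  rw [localDensity, detS_moveChart, enorm_mul,
    ENNReal.mul_rpow_of_ne_top enorm_ne_top enorm_ne_top]
  rfl

end

variable [MeasurableSpace X] [BorelSpace X]

/-- The canonical measure charges the preimages of open sets. -/
lemma canonicalMeasure_eval_preimage_ne_zero {k : ℕ}
    (b : Module.Basis (Fin (Nk n X k)) ℂ (H0 n X k)) (i : Fin (Nk n X k)) {U : Set X}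
    (hU : IsOpen U) (hUn : U.Nonempty) :
    canonicalMeasure b ((fun x => x i) ⁻¹' U) ≠ 0 := by
  obtain ⟨x, hx⟩ := hUn
  set e₀ := chartH n x
  let e : Fin (Nk n X k) → HolChart n X := fun _ => e₀
  suffices h : localMeasure b e ((fun x => x i) ⁻¹' U) ≠ 0 from fun h0 =>
    h (le_antisymm ((localMeasure_le_canonicalMeasure b e _).trans h0.le) zero_le)
  rw [localMeasure, Measure.map_apply_of_aemeasurable (aemeasurable_prodSymm_withDensity b e)
    ((measurable_pi_apply i) hU.measurableSet)]
  let O : Set (Fin (Nk n X k) → Fin n → ℂ) :=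
    Set.univ.pi fun _ => e₀.1.symm.source ∩ e₀.1.symm ⁻¹' U
  have hO : IsOpen O := isOpen_set_pi Set.finite_univ fun _ _ => e₀.1.symm.isOpen_inter_preimage hU
  have hxO : (fun _ => e₀.1 x) ∈ O := fun _ _ => by
    have hxe : x ∈ e₀.1.source := mem_chartH_source x
    refine ⟨e₀.1.map_source hxe, ?_⟩
    rw [Set.mem_preimage, e₀.1.left_inv hxe]
    exact hx
  have hOT : O ⊆ prodTarget e := fun z hz j => (hz j trivial).1
  refine ne_of_gt (lt_of_lt_of_le (pos_iff_ne_zero.2 ?_) (measure_mono (s := O) fun z hz =>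
    (hz i trivial).2))
  rw [Ne, withDensity_apply_eq_zero' (measurable_localDensity b 1 e).aemeasurable]
  -- The exponent is non-positive and the determinant finite, so the density never vanishes; it is
  -- infinite, not zero, on the divisor when `k > 0`.
  have huniv : {z | localDensity b 1 e z ≠ 0} = Set.univ := by
    refine Set.eq_univ_of_forall fun z => ?_
    change ‖detS b e z‖ₑ ^ _ ≠ 0
    have hk : 0 ≤ 2 * (1 : ℝ) / k := by positivity
    rw [Ne, ENNReal.rpow_eq_zero_iff]
    rintro (⟨-, h⟩ | ⟨h, -⟩)
    · linarith
    · exact enorm_ne_top h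
  rw [huniv, Set.univ_inter, Measure.restrict_apply hO.measurableSet,
    Set.inter_eq_left.2 hOT]
  have h1 : (volume : Measure (Fin n → ℂ)).IsOpenPosMeasure :=
    inferInstanceAs (Measure.pi fun _ : Fin n => (volume : Measure ℂ)).IsOpenPosMeasure
  have h2 : (volume : Measure (Fin (Nk n X k) → Fin n → ℂ)).IsOpenPosMeasure :=
    inferInstanceAs (Measure.pi fun _ : Fin (Nk n X k) =>
      (volume : Measure (Fin n → ℂ))).IsOpenPosMeasure
  exact (hO.measure_pos _ ⟨_, hxO⟩).ne'

/-- Moved charts have the same targets, so Lebesgue measure is unchanged and only the density is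
rescaled. -/
lemma localMeasure_moveChart (φ : Diffeomorph 𝓘(ℂ, Fin n → ℂ) 𝓘(ℂ, Fin n → ℂ) X X ω) {k : ℕ}
    (b : Module.Basis (Fin (Nk n X k)) ℂ (H0 n X k)) (e : Fin (Nk n X k) → HolChart n X) :
    localMeasure b (fun j => moveChart φ (e j)) =
      (‖LinearMap.det (pullback φ (X := X) k)‖ₑ ^ (-(2 * 1 / k) : ℝ)) •
        (localMeasure b e).map fun x j => φ (x j) := by
  rw [localMeasure, localDensity_moveChart, localMeasure,
    AEMeasurable.map_map_of_aemeasurable (measurable_diagonal_map φ _).aemeasurable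
      (aemeasurable_prodSymm_withDensity b e), ← Measure.map_smul,
    withDensity_smul _ (measurable_localDensity b 1 e)]
  rfl

/-- Every family of charts is the `φ`-image of another family, so the bound holds for each term of
the supremum. -/
lemma canonicalMeasure_le_map (φ : Diffeomorph 𝓘(ℂ, Fin n → ℂ) 𝓘(ℂ, Fin n → ℂ) X X ω) {k : ℕ}
    (b : Module.Basis (Fin (Nk n X k)) ℂ (H0 n X k)) :
    canonicalMeasure b ≤ (‖LinearMap.det (pullback φ (X := X) k)‖ₑ ^ (-(2 * 1 / k) : ℝ)) •
        (canonicalMeasure b).map fun x j => φ (x j) := by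
  refine iSup_le fun e => ?_
  have h := localMeasure_moveChart φ b fun j => moveChart φ.symm (e j)
  simp only [moveChart_symm_moveChart] at h
  rw [h]
  gcongr
  · exact measurable_diagonal_map φ _
  · exact localMeasure_le_canonicalMeasure b _

/-- A biholomorphic map preserves the canonical measure, if this is finite. -/
lemma measurePreserving_canonicalMeasure
    (φ : Diffeomorph 𝓘(ℂ, Fin n → ℂ) 𝓘(ℂ, Fin n → ℂ) X X ω) {k : ℕ}
    (b : Module.Basis (Fin (Nk n X k)) ℂ (H0 n X k)) (hfin : partitionFunction b ≠ ⊤)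
    (h0 : partitionFunction b ≠ 0) :
    MeasurePreserving (fun (x : Fin (Nk n X k) → X) j => φ (x j)) (canonicalMeasure b)
      (canonicalMeasure b) := by
  have hm := measurable_diagonal_map φ (Nk n X k)
  -- Comparing total masses bounds the scaling factor below by one. The factors of `φ` and `φ.symm`
  -- have product one, so both equal one.
  have key : ∀ ψ : Diffeomorph 𝓘(ℂ, Fin n → ℂ) 𝓘(ℂ, Fin n → ℂ) X X ω,
      1 ≤ ‖LinearMap.det (pullback ψ (X := X) k)‖ₑ ^ (-(2 * 1 / k) : ℝ) := by
    intro ψ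
    have h := canonicalMeasure_le_map ψ b Set.univ
    rw [Measure.smul_apply, Measure.map_apply (measurable_diagonal_map ψ _) MeasurableSet.univ,
      Set.preimage_univ, smul_eq_mul] at h
    change partitionFunction b ≤ _ * partitionFunction b at h
    by_contra hlt
    refine absurd h (not_le.2 ?_)
    calc _ < 1 * partitionFunction b := ENNReal.mul_lt_mul_left h0 hfin (not_le.1 hlt)
      _ = _ := one_mul _
  have hmul : ‖LinearMap.det (pullback φ.symm (X := X) k)‖ₑ ^ (-(2 * 1 / k) : ℝ) *
      ‖LinearMap.det (pullback φ (X := X) k)‖ₑ ^ (-(2 * 1 / k) : ℝ) = 1 := by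
    rw [← ENNReal.mul_rpow_of_ne_top enorm_ne_top enorm_ne_top, ← enorm_mul,
      det_pullback_symm_mul, enorm_one, ENNReal.one_rpow]
  have hone : ‖LinearMap.det (pullback φ (X := X) k)‖ₑ ^ (-(2 * 1 / k) : ℝ) = 1 := by
    refine le_antisymm ?_ (key φ)
    calc _ = 1 * ‖LinearMap.det (pullback φ (X := X) k)‖ₑ ^ (-(2 * 1 / k) : ℝ) := (one_mul _).symm
      _ ≤ _ := mul_le_mul_left (key φ.symm) _
      _ = 1 := hmul
  have hle := canonicalMeasure_le_map φ b
  rw [hone, one_smul] at hle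
  have hfm : IsFiniteMeasure (canonicalMeasure b) := ⟨lt_top_iff_ne_top.2 hfin⟩
  refine ⟨hm, (Measure.eq_of_le_of_measure_univ_eq hle ?_).symm⟩
  rw [Measure.map_apply hm MeasurableSet.univ, Set.preimage_univ]

end Transport

/-! ### Divergence of the partition function. -/

section Divergence

variable {n : ℕ} {X : Type*} [TopologicalSpace X] [ChartedSpace (Fin n → ℂ) X]
  [IsManifold 𝓘(ℂ, Fin n → ℂ) ω X] [CompactSpace X]

/-- The Lie derivative along a non-zero vector field, on the sections of a very ample bundle, has
two distinct eigenvalues or a Jordan block. -/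
lemma VField.exists_eigensections (V : VField n X) {x : X}
    (hV : V.coeff (chartH n x) ((chartH n x).1 x) ≠ 0) {m : ℕ} (h : VeryAmple n X m) :
    (∃ (s t : H0 n X m) (μ ν : ℂ), s ≠ 0 ∧ t ≠ 0 ∧ μ ≠ ν ∧ V.lieDeriv m s = μ • s ∧
      V.lieDeriv m t = ν • t) ∨
    ∃ (s t : H0 n X m) (μ : ℂ), t ≠ 0 ∧ V.lieDeriv m s = μ • s + t ∧ V.lieDeriv m t = μ • t := by
  have hx := mem_chartH_source (n := n) x
  have hnt : Nontrivial (H0 n X m) := by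
    obtain ⟨s, hs, hs0⟩ := h.1 x
    refine ⟨⟨s, hs⟩, 0, fun h0 => hs0 _ hx ?_⟩
    have := congrArg (fun s : H0 n X m => s.1 (chartH n x) ((chartH n x).1 x)) h0
    exact this
  set A : Module.End ℂ (H0 n X m) := V.lieDeriv m with hA
  obtain ⟨μ, hμ⟩ := Module.End.exists_eigenvalue A
  let N : Module.End ℂ (H0 n X m) := A - algebraMap ℂ _ μ
  have hN : ∀ s, N s = A s - μ • s := fun s => rfl
  by_cases hN0 : N = 0
  · exfalso
    -- A scalar Lie derivative would force `ds(V) = 0` at `x` for every section vanishing at `x`,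
    -- against the separation of tangent directions.
    obtain ⟨s, hs, hs0, hsV⟩ := h.2.2 x (chartH n x) hx _ hV
    have h1 : A ⟨s, hs⟩ = μ • (⟨s, hs⟩ : H0 n X m) :=
      sub_eq_zero.1 (DFunLike.congr_fun hN0 (⟨s, hs⟩ : H0 n X m))
    have h2 := congrArg (fun s : H0 n X m => s.1 (chartH n x) ((chartH n x).1 x)) h1
    simp only [hA] at h2
    rw [V.lieDeriv_apply _ hx] at h2
    refine hsV ?_
    change fderiv ℂ (s (chartH n x)) _ _ - _ * s (chartH n x) _ = μ * s (chartH n x) _ at h2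
    rwa [hs0, mul_zero, mul_zero, sub_zero] at h2
  · have hcomm : ∀ s, A (N s) = N (A s) := fun s => by
      simp only [hN, map_sub, map_smul]
    -- An eigenvector `t` in the range of `A - μ` has either an eigenvalue different from `μ`, or
    -- eigenvalue `μ` and a preimage completing a Jordan chain.
    let R : Submodule ℂ (H0 n X m) := LinearMap.range N
    have hR : ∀ s ∈ R, A s ∈ R := by
      rintro _ ⟨s, rfl⟩
      exact ⟨A s, (hcomm s).symm⟩
    have hRnt : Nontrivial R := by
      rw [Submodule.nontrivial_iff_ne_bot]
      exact fun h0 => hN0 (LinearMap.range_eq_bot.1 h0)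
    let A' : Module.End ℂ R := LinearMap.restrict A hR
    obtain ⟨ν, hν⟩ := Module.End.exists_eigenvalue (K := ℂ) (V := R) A'
    obtain ⟨⟨t, ht⟩, htν⟩ := hν.exists_hasEigenvector
    have ht0 : t ≠ 0 := fun h0 => htν.2 (Subtype.ext h0)
    have htA : A t = ν • t := congrArg Subtype.val htν.apply_eq_smul
    by_cases hμν : μ = ν
    · right
      obtain ⟨s, hs⟩ := ht
      refine ⟨s, t, μ, ht0, ?_, hμν ▸ htA⟩
      rw [← hs, hN]
      abel
    · left
      obtain ⟨s, hs⟩ := hμ.exists_hasEigenvector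
      exact ⟨s, t, μ, ν, hs.2, ht0, hμν, hs.apply_eq_smul, htA⟩

variable [ConnectedSpace X] [MeasurableSpace X] [BorelSpace X]

/-- The canonical partition function diverges on a manifold with a non-zero holomorphic vector
field. -/
theorem VField.partitionFunction_eq_top (V : VField n X) {x : X}
    (hV : V.coeff (chartH n x) ((chartH n x).1 x) ≠ 0) {m : ℕ} (h : VeryAmple n X m) {k : ℕ}
    (hk : 0 < Nk n X k) (b : Module.Basis (Fin (Nk n X k)) ℂ (H0 n X k)) :
    partitionFunction b = ⊤ := by
  by_contra hfin
  let i : Fin (Nk n X k) := ⟨0, hk⟩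
  have h0 : partitionFunction b ≠ 0 := by
    have := canonicalMeasure_eval_preimage_ne_zero b i isOpen_univ ⟨x, trivial⟩
    rwa [Set.preimage_univ] at this
  have hei : Measurable fun x : Fin (Nk n X k) → X => x i := measurable_pi_apply i
  -- The marginal on one factor; projection intertwines the diagonal action with `φ`, so invariance
  -- passes to `ν`.
  let ν : Measure X := (canonicalMeasure b).map fun x => x i
  have hfm : IsFiniteMeasure (canonicalMeasure b) := ⟨lt_top_iff_ne_top.2 hfin⟩
  have hνU : ∀ U : Set X, IsOpen U → U.Nonempty → ν U ≠ 0 := by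
    intro U hU hUn
    rw [Measure.map_apply hei hU.measurableSet]
    exact canonicalMeasure_eval_preimage_ne_zero b i hU hUn
  have hmp : ∀ φ : Diffeomorph 𝓘(ℂ, Fin n → ℂ) 𝓘(ℂ, Fin n → ℂ) X X ω,
      MeasurePreserving φ ν ν := by
    intro φ
    have h1 := measurePreserving_canonicalMeasure φ b hfin h0
    refine ⟨φ.continuous.measurable, ?_⟩
    rw [Measure.map_map φ.continuous.measurable hei]
    change (canonicalMeasure b).map ((fun x : Fin (Nk n X k) → X => x i) ∘
      fun (x : Fin (Nk n X k) → X) j => φ (x j)) = _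
    rw [← Measure.map_map hei h1.measurable, h1.map_eq]
  rcases V.exists_eigensections hV h with ⟨s, t, μ, μ', hs, ht, hne, hsμ, htμ⟩ | ⟨s, t, μ, ht, hsμ, htμ⟩
  -- The conjugate as complex time makes the character `exp (‖μ - μ'‖ ^ 2)`, whose logarithm is
  -- non-zero even if `μ - μ'` is imaginary.
  · obtain ⟨φ, hφ⟩ := V.exists_diffeomorph h (starRingEnd ℂ (μ - μ'))
    have hU : IsOpen (H0.support s ∩ H0.support t) := (H0.isOpen_support s).inter (H0.isOpen_support t)
    refine hνU _ hU (H0.nonempty_support_inter hs ht) ?_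
    refine measure_eq_zero_of_translation (hmp φ) hU.measurableSet
      (fun y hy => ⟨(map_mem_support_iff hφ h hsμ y).2 hy.1, (map_mem_support_iff hφ h htμ y).2 hy.2⟩)
      (f := fun y => Real.log ‖H0.ratio s t y‖) (H0.measurable_ratio s t).norm.log
      (d := ‖μ - μ'‖ ^ 2) ?_ ?_
    · exact pow_ne_zero _ (norm_ne_zero_iff.2 (sub_ne_zero.2 hne))
    · intro y hy
      have hr : H0.ratio s t y ≠ 0 := div_ne_zero hy.1 hy.2
      rw [ratio_map_of_eigensections hφ h hsμ htμ, norm_mul, Real.log_mul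
        (norm_ne_zero_iff.2 (Complex.exp_ne_zero _)) (norm_ne_zero_iff.2 hr), Complex.norm_exp,
        Real.log_exp, Complex.conj_mul', add_comm]
      norm_cast
  · obtain ⟨φ, hφ⟩ := V.exists_diffeomorph h 1
    refine hνU _ (H0.isOpen_support t) (H0.dense_support ht).nonempty ?_
    refine measure_eq_zero_of_translation (hmp φ) (H0.isOpen_support t).measurableSet
      (fun y hy => (map_mem_support_iff hφ h htμ y).2 hy)
      (f := fun y => (H0.ratio s t y).re) (Complex.measurable_re.comp (H0.measurable_ratio s t))
      one_ne_zero fun y hy => ?_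
    rw [ratio_map_of_generalized_eigensection hφ h hsμ htμ hy, Complex.add_re, Complex.one_re]

end Divergence

/-! ### Compatibility of the local measures. -/

section ChangeOfCoordinates

variable {n : ℕ} {X : Type*} [TopologicalSpace X] [ChartedSpace (Fin n → ℂ) X]

/-- The real Jacobian of a complex linear map is the squared modulus of its complex determinant. -/
lemma det_restrictScalars_pi {N : ℕ} (L : Fin N → (Fin n → ℂ) →L[ℂ] (Fin n → ℂ)) :
    ((ContinuousLinearMap.pi fun j => (L j).comp (ContinuousLinearMap.proj j)).restrictScalars
      ℝ).det = ‖∏ j, (L j).det‖ ^ 2 := by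
  have h1 := LinearMap.det_restrictScalars (R := ℝ) (S := ℂ) (A := Fin N → Fin n → ℂ)
    (f := (ContinuousLinearMap.pi fun j => (L j).comp
      (ContinuousLinearMap.proj (R := ℂ) (φ := fun _ : Fin N => Fin n → ℂ) j)).toLinearMap)
  rw [Algebra.norm_complex_apply] at h1
  have h2 : LinearMap.det (ContinuousLinearMap.pi fun j => (L j).comp
      (ContinuousLinearMap.proj (R := ℂ) (φ := fun _ : Fin N => Fin n → ℂ) j)).toLinearMap =
        ∏ j, (L j).det :=
    LinearMap.det_pi fun j => (L j).toLinearMap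
  rw [h2, Complex.normSq_eq_norm_sq] at h1
  exact h1

lemma detS_transition {k : ℕ} (b : Module.Basis (Fin (Nk n X k)) ℂ (H0 n X k))
    {e e' : Fin (Nk n X k) → HolChart n X} {z : Fin (Nk n X k) → Fin n → ℂ}
    (hz : ∀ j, z j ∈ overlap (e j) (e' j)) :
    detS b e' (fun j => transition (e j) (e' j) (z j)) =
      (∏ j, jacobian (e j) (e' j) (z j)) ^ k * detS b e z := by
  rw [detS, detS, ← Finset.prod_pow, ← Matrix.det_mul_row]
  congr 1
  ext i j
  have h := mem_overlap.1 (hz j)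
  have := H0.apply_eq (b i) ((e j).1.map_target h.1) h.2
  rwa [(e j).1.right_inv h.1] at this

/-- The exponent `-2 / k` turns the factor `J ^ k` of `det S` into `|J| ^ (-2)`, exactly cancelling
the real Jacobian. This is why the density is globally defined. -/
lemma localDensity_transition {k : ℕ} (hk : 0 < k)
    (b : Module.Basis (Fin (Nk n X k)) ℂ (H0 n X k))
    {e e' : Fin (Nk n X k) → HolChart n X} {z : Fin (Nk n X k) → Fin n → ℂ}
    (hz : ∀ j, z j ∈ overlap (e j) (e' j)) :
    ENNReal.ofReal (‖∏ j, jacobian (e j) (e' j) (z j)‖ ^ 2) *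
      localDensity b 1 e' (fun j => transition (e j) (e' j) (z j)) = localDensity b 1 e z := by
  have h0 : ∏ j, jacobian (e j) (e' j) (z j) ≠ 0 := Finset.prod_ne_zero_iff.2 fun j _ => by
    have h := mem_overlap.1 (hz j)
    have := jacobian_ne_zero ((e j).1.map_target h.1) h.2
    rwa [(e j).1.right_inv h.1] at this
  set J := ∏ j, jacobian (e j) (e' j) (z j)
  have hk' : (k : ℝ) ≠ 0 := Nat.cast_ne_zero.2 hk.ne'
  rw [localDensity, detS_transition b hz, localDensity, enorm_mul, enorm_pow,
    ENNReal.mul_rpow_of_ne_top (ENNReal.pow_ne_top enorm_ne_top) enorm_ne_top,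
    ← ENNReal.rpow_natCast, ← ENNReal.rpow_mul, ← mul_assoc, ENNReal.ofReal_pow (norm_nonneg _),
    ofReal_norm, ← ENNReal.rpow_natCast, ← ENNReal.rpow_add _ _ (enorm_ne_zero.2 h0) enorm_ne_top]
  have : ((2 : ℕ) : ℝ) + k * -(2 * 1 / k) = 0 := by
    field_simp
    norm_num
  rw [this, ENNReal.rpow_zero, one_mul]

lemma hasFDerivAt_prodTransition {N : ℕ} {e e' : Fin N → HolChart n X}
    {z : Fin N → Fin n → ℂ} (hz : ∀ j, z j ∈ overlap (e j) (e' j)) :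
    HasFDerivAt (fun (z : Fin N → Fin n → ℂ) j => transition (e j) (e' j) (z j))
      ((ContinuousLinearMap.pi fun j => (fderiv ℂ (transition (e j) (e' j)) (z j)).comp
        (ContinuousLinearMap.proj j)).restrictScalars ℝ) z := by
  refine HasFDerivAt.restrictScalars ℝ (hasFDerivAt_pi.2 fun j => ?_)
  have h := (analyticOnNhd_transition (e j) (e' j) _ (hz j)).differentiableAt.hasFDerivAt
  exact HasFDerivAt.comp (f := fun z : Fin N → Fin n → ℂ => z j) z h (hasFDerivAt_apply j z)

variable [MeasurableSpace X] [BorelSpace X]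

/-- The inverse charts are controlled only on their targets, so measurability is proved on the
subtype and pushed forward. -/
lemma measurableSet_prodTarget_inter_preimage {N : ℕ} (e : Fin N → HolChart n X)
    {B : Set (Fin N → X)} (hB : MeasurableSet B) :
    MeasurableSet (prodTarget e ∩ (fun z j => (e j).1.symm (z j)) ⁻¹' B) := by
  have hT := (isOpen_prodTarget e).measurableSet
  have h : Measurable ((prodTarget e).domRestrict fun z j => (e j).1.symm (z j)) :=
    measurable_pi_lambda _ fun j => Continuous.measurable <| ContinuousOn.domRestrict
      (f := fun z : Fin N → Fin n → ℂ => (e j).1.symm (z j)) <|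
      (e j).1.continuousOn_symm.comp (continuous_apply j).continuousOn fun z hz => hz j
  have := hT.subtype_image (h hB)
  rwa [Set.domRestrict_eq, Set.preimage_comp, Subtype.image_preimage_coe] at this

lemma localMeasure_apply {k : ℕ} (b : Module.Basis (Fin (Nk n X k)) ℂ (H0 n X k))
    (e : Fin (Nk n X k) → HolChart n X) {B : Set (Fin (Nk n X k) → X)} (hB : MeasurableSet B) :
    localMeasure b e B = ∫⁻ z in prodTarget e ∩ (fun z j => (e j).1.symm (z j)) ⁻¹' B,
      localDensity b 1 e z := by
  have h := (aemeasurable_prodSymm (X := X) e).nullMeasurableSet_preimage hB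
  rw [localMeasure, Measure.map_apply_of_aemeasurable (aemeasurable_prodSymm_withDensity b e) hB,
    withDensity_apply₀ _ h, Measure.restrict_restrict₀ h, Set.inter_comm]

/-- The local measures agree on the overlaps of chart domains. -/
lemma localMeasure_le_of_subset {k : ℕ} (hk : 0 < k)
    (b : Module.Basis (Fin (Nk n X k)) ℂ (H0 n X k)) (e e' : Fin (Nk n X k) → HolChart n X)
    {B : Set (Fin (Nk n X k) → X)} (hB : MeasurableSet B)
    (hBe : ∀ x ∈ B, ∀ j, x j ∈ (e j).1.source) : localMeasure b e' B ≤ localMeasure b e B := by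
  rw [localMeasure_apply b e' hB, localMeasure_apply b e hB]
  set A := prodTarget e ∩ (fun z j => (e j).1.symm (z j)) ⁻¹' B
  let O : Set (Fin (Nk n X k) → Fin n → ℂ) := Set.univ.pi fun j => overlap (e j) (e' j)
  have hO : IsOpen O := isOpen_set_pi Set.finite_univ fun j _ => isOpen_overlap _ _
  have hAO : MeasurableSet (A ∩ O) :=
    (measurableSet_prodTarget_inter_preimage e hB).inter hO.measurableSet
  -- As `B` lies in the domain of `e`, its `e'`-coordinates are reached by transition from `e`; the
  -- change of variables formula then applies.
  have himage : prodTarget e' ∩ (fun z j => (e' j).1.symm (z j)) ⁻¹' B ⊆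
      (fun z j => transition (e j) (e' j) (z j)) '' (A ∩ O) := by
    rintro w ⟨hw, hwB⟩
    have hs := hBe _ hwB
    have hs' : ∀ j, (e' j).1.symm (w j) ∈ (e' j).1.source := fun j => (e' j).1.map_target (hw j)
    refine ⟨fun j => (e j).1 ((e' j).1.symm (w j)), ⟨⟨fun j => (e j).1.map_source (hs j), ?_⟩,
      fun j _ => overlap_apply_mem (hs j) (hs' j)⟩, ?_⟩
    · have : (fun j => (e j).1.symm ((e j).1 ((e' j).1.symm (w j)))) =
          fun j => (e' j).1.symm (w j) := funext fun j => (e j).1.left_inv (hs j)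
      rw [Set.mem_preimage, this]
      exact hwB
    · funext j
      simp only [transition]
      rw [(e j).1.left_inv (hs j), (e' j).1.right_inv (hw j)]
  have hinj : Set.InjOn (fun (z : Fin (Nk n X k) → Fin n → ℂ) j => transition (e j) (e' j) (z j))
      (A ∩ O) := by
    intro z hz w hw hzw
    funext j
    exact ((e j).1.symm.trans (e' j).1).injOn (hz.2 j trivial) (hw.2 j trivial) (congrFun hzw j)
  have hHaar : (volume : Measure (Fin n → ℂ)).IsAddHaarMeasure :=
    inferInstanceAs (Measure.pi fun _ : Fin n => (volume : Measure ℂ)).IsAddHaarMeasure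
  have hHaar' : (volume : Measure (Fin (Nk n X k) → Fin n → ℂ)).IsAddHaarMeasure :=
    Measure.pi.isAddHaarMeasure fun _ : Fin (Nk n X k) => (volume : Measure (Fin n → ℂ))
  refine (lintegral_mono_set himage).trans ?_
  rw [lintegral_image_eq_lintegral_abs_det_fderiv_mul volume hAO
    (fun z hz => (hasFDerivAt_prodTransition fun j => hz.2 j trivial).hasFDerivWithinAt) hinj]
  refine le_trans (le_of_eq ?_) (lintegral_mono_set (Set.inter_subset_left (t := O)))
  refine setLIntegral_congr_fun hAO fun z hz => ?_
  rw [det_restrictScalars_pi, abs_of_nonneg (by positivity)]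
  exact localDensity_transition hk b fun j => hz.2 j trivial

end ChangeOfCoordinates

/-! ### From local integrability to finiteness of the partition function. -/

section LogCanonicalThreshold

variable {n : ℕ} {X : Type*} [TopologicalSpace X] [ChartedSpace (Fin n → ℂ) X]

lemma continuousOn_detS {k : ℕ} (b : Module.Basis (Fin (Nk n X k)) ℂ (H0 n X k))
    (e : Fin (Nk n X k) → HolChart n X) : ContinuousOn (detS b e) (prodTarget e) := by
  unfold detS
  simp only [Matrix.det_apply, Matrix.of_apply]
  refine continuousOn_finsetSum _ fun σ _ => ContinuousOn.const_smul ?_ _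
  refine continuousOn_finsetProd _ fun j _ => ?_
  exact ((b (σ j)).2.1 (e j)).continuousOn.comp (continuous_apply j).continuousOn fun z hz => hz j

/-- On a compact set `|det S|` is bounded, so `|det S| ^ (-2 / k)` is at most a constant times `|det
S| ^ (-2t / k)`. -/
lemma LocIntegrable.one {k : ℕ} (hk : 0 < k) {b : Module.Basis (Fin (Nk n X k)) ℂ (H0 n X k)}
    {t : ℝ} (ht : 1 ≤ t) (h : LocIntegrable b t) : LocIntegrable b 1 := by
  intro e K hK hKc
  obtain ⟨M, hM⟩ := hKc.exists_bound_of_continuousOn ((continuousOn_detS b e).mono hK)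
  let C : ℝ≥0∞ := ENNReal.ofReal (max M 1) ^ (2 * (t - 1) / k : ℝ)
  have hk' : (0 : ℝ) < k := Nat.cast_pos.2 hk
  have hC0 : ENNReal.ofReal (max M 1) ≠ 0 := (ENNReal.ofReal_pos.2 (by positivity)).ne'
  have hexp : 0 ≤ 2 * (t - 1) / k := div_nonneg (by linarith) hk'.le
  have hC : C ≠ ⊤ := ENNReal.rpow_ne_top_of_nonneg hexp ENNReal.ofReal_ne_top
  have hCne : C ≠ 0 := by
    rw [Ne, ENNReal.rpow_eq_zero_iff]
    rintro (⟨h0, -⟩ | ⟨h0, -⟩)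
    · exact hC0 h0
    · exact ENNReal.ofReal_ne_top h0
  have hle : ∀ z ∈ K, localDensity b 1 e z ≤ C * localDensity b t e z := by
    intro z hz
    rw [localDensity, localDensity]
    -- On the divisor the right side is `C * ⊤`, which is `⊤` only because `C` is non-zero.
    by_cases hr : ‖detS b e z‖ₑ = 0
    · have : -(2 * t / k) < 0 := neg_neg_of_pos (by positivity)
      rw [hr, ENNReal.zero_rpow_of_neg this, ENNReal.mul_top hCne]
      exact le_top
    · have hsum : -(2 * 1 / k) = 2 * (t - 1) / k + -(2 * t / k) := by ring
      rw [hsum, ENNReal.rpow_add _ _ hr enorm_ne_top]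
      refine mul_le_mul_left (ENNReal.rpow_le_rpow ?_ hexp) _
      rw [← ofReal_norm]
      exact ENNReal.ofReal_le_ofReal ((hM z hz).trans (le_max_left _ _))
  calc ∫⁻ z in K, localDensity b 1 e z ≤ ∫⁻ z in K, C * localDensity b t e z :=
        setLIntegral_mono ((measurable_localDensity b t e).const_mul C) hle
    _ = C * ∫⁻ z in K, localDensity b t e z :=
        lintegral_const_mul C (measurable_localDensity b t e)
    _ < ⊤ := ENNReal.mul_lt_top hC.lt_top (h e K hK hKc)

variable [IsManifold 𝓘(ℂ, Fin n → ℂ) ω X] [CompactSpace X] [T2Space X]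

/-- Finitely many compact boxes inside chart domains cover `X ^ N_k`. As local measures agree on
overlaps, the supremum over all charts is dominated by the finite sum of local measures on these
boxes. -/
lemma LocIntegrable.partitionFunction_lt_top [MeasurableSpace X] [BorelSpace X] {k : ℕ}
    (hk : 0 < k) {b : Module.Basis (Fin (Nk n X k)) ℂ (H0 n X k)} (h : LocIntegrable b 1) :
    partitionFunction b < ⊤ := by
  have hex : ∀ x : X, ∃ K : Set X, IsCompact K ∧ x ∈ interior K ∧ K ⊆ (chartH n x).1.source :=
    fun x => exists_compact_subset (chartH n x).1.open_source (mem_chartH_source x)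
  choose K hKc hxK hKs using hex
  obtain ⟨T, hT⟩ := isCompact_univ.elim_finite_subcover (fun x => interior (K x))
    (fun x => isOpen_interior) fun x _ => Set.mem_iUnion.2 ⟨x, hxK x⟩
  let box (a : Fin (Nk n X k) → T) : Set (Fin (Nk n X k) → X) :=
    Set.univ.pi fun j => K (a j)
  let e (a : Fin (Nk n X k) → T) : Fin (Nk n X k) → HolChart n X := fun j => chartH n (a j).1
  have hbox : ∀ a, MeasurableSet (box a) := fun a =>
    MeasurableSet.univ_pi fun j => (hKc _).measurableSet
  have hcover : ∀ x : Fin (Nk n X k) → X, ∃ a, x ∈ box a := by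
    intro x
    have hx : ∀ j, ∃ y : T, x j ∈ K y := fun j => by
      obtain ⟨y, hy, hxy⟩ := Set.mem_iUnion₂.1 (hT (Set.mem_univ (x j)))
      exact ⟨⟨y, hy⟩, interior_subset hxy⟩
    choose a ha using hx
    exact ⟨a, fun j _ => ha j⟩
  have hle : canonicalMeasure b ≤ Measure.sum fun a => (localMeasure b (e a)).restrict (box a) := by
    refine iSup_le fun e' => Measure.le_iff.2 fun S hS => ?_
    rw [Measure.sum_apply _ hS]
    calc localMeasure b e' S ≤ localMeasure b e' (⋃ a, S ∩ box a) := measure_mono fun x hx => by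
          obtain ⟨a, ha⟩ := hcover x
          exact Set.mem_iUnion.2 ⟨a, hx, ha⟩
      _ ≤ ∑' a, localMeasure b e' (S ∩ box a) := measure_iUnion_le _
      _ ≤ ∑' a, (localMeasure b (e a)).restrict (box a) S := ENNReal.tsum_le_tsum fun a => by
          rw [Measure.restrict_apply hS]
          exact localMeasure_le_of_subset hk b _ _ (hS.inter (hbox a))
            fun x hx j => hKs _ (hx.2 j trivial)
  refine (hle Set.univ).trans_lt ?_
  rw [Measure.sum_apply _ MeasurableSet.univ, tsum_fintype, ENNReal.sum_lt_top]
  intro a _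
  rw [Measure.restrict_apply_univ, localMeasure_apply b (e a) (hbox a)]
  refine lt_of_le_of_lt (lintegral_mono_set (t := Set.univ.pi fun j =>
    (chartH n (a j).1).1 '' K (a j)) fun z hz j _ => ?_) (h (e a) _ ?_ ?_)
  · exact ⟨_, hz.2 j trivial, (chartH n (a j).1).1.right_inv (hz.1 j)⟩
  · intro z hz j
    obtain ⟨x, hx, hxz⟩ := hz j trivial
    rw [← hxz]
    exact (chartH n (a j).1).1.map_source (hKs _ hx)
  · exact isCompact_univ_pi fun j => (hKc _).image_of_continuousOn
      ((chartH n (a j).1).1.continuousOn.mono (hKs _))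

/-- The anticanonical log canonical threshold is at most one if the partition function diverges. -/
lemma lct_le_one [MeasurableSpace X] [BorelSpace X] {k : ℕ} (hk : 0 < k)
    (b : Module.Basis (Fin (Nk n X k)) ℂ (H0 n X k)) (h : partitionFunction b = ⊤) :
    lct n X k ≤ 1 := by
  refine iSup₂_le fun t ht => ?_
  by_contra hlt
  rw [not_le, ENNReal.one_lt_coe_iff] at hlt
  exact ((ht b).one hk (NNReal.one_le_coe.2 hlt.le) |>.partitionFunction_lt_top hk).ne h

end LogCanonicalThreshold

/-! ### Assembly of the result. -/

section Main

variable {n : ℕ} {X : Type*} [TopologicalSpace X] [ChartedSpace (Fin n → ℂ) X]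
  [IsManifold 𝓘(ℂ, Fin n → ℂ) ω X] [CompactSpace X] [ConnectedSpace X]
  [MeasurableSpace X] [BorelSpace X]

/-- The canonical partition functions of a Fano manifold with a non-zero holomorphic vector field
diverge. -/
theorem eventually_partitionFunction_eq_top (hFano : AnticanonicalAmple n X)
    {v : ∀ x : X, TangentSpace 𝓘(ℂ, Fin n → ℂ) x}
    (hv : ContMDiff 𝓘(ℂ, Fin n → ℂ) 𝓘(ℂ, Fin n → ℂ).tangent ω
      (fun x => (⟨x, v x⟩ : TangentBundle 𝓘(ℂ, Fin n → ℂ) X))) (hv0 : v ≠ 0) :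
    ∀ᶠ k : ℕ in atTop, ∀ b : Module.Basis (Fin (Nk n X k)) ℂ (H0 n X k),
      partitionFunction b = ⊤ := by
  obtain ⟨x, hx⟩ := Function.ne_iff.1 hv0
  have hV : (VField.ofContMDiff hv).coeff (chartH n x) ((chartH n x).1 x) ≠ 0 := by
    rw [VField.ofContMDiff_coeff hv x]
    exact hx
  have := hFano.eventually_Nk_pos
  obtain ⟨m, -, h⟩ := hFano
  filter_upwards [this] with k hk b
  exact (VField.ofContMDiff hv).partitionFunction_eq_top hV h hk b

end Main

end Fano

end

theorem mainTheorem12 (n : ℕ) (X : Type*) [TopologicalSpace X] [T2Space X] [CompactSpace X]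
    [ConnectedSpace X] [ChartedSpace (Fin n → ℂ) X] [IsManifold 𝓘(ℂ, Fin n → ℂ) ω X]
    [MeasurableSpace X] [BorelSpace X]
    (hFano : Fano.AnticanonicalAmple n X)
    (hvf : ∃ v : ∀ x : X, TangentSpace 𝓘(ℂ, Fin n → ℂ) x,
      ContMDiff 𝓘(ℂ, Fin n → ℂ) 𝓘(ℂ, Fin n → ℂ).tangent ω
        (fun x => (⟨x, v x⟩ : TangentBundle 𝓘(ℂ, Fin n → ℂ) X)) ∧ v ≠ 0) :
    (∀ᶠ k : ℕ in atTop, ∀ b : Module.Basis (Fin (Fano.Nk n X k)) ℂ (Fano.H0 n X k),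
      Fano.partitionFunction b = ⊤) ∧
    Fano.gammaInv n X ≤ 1 ∧
    ¬ Fano.AsymptoticallyGibbsStable n X := by
  have htop := Fano.eventually_partitionFunction_eq_top hFano hvf.choose_spec.1 hvf.choose_spec.2
  refine ⟨htop, ?_, fun hstable => ?_⟩
  -- Any eventual lower bound for the thresholds holds at some `k > 0` where the partition function
  -- diverges, and there the threshold is at most one.
  · refine Filter.liminf_le_of_le (by isBoundedDefault) fun c hc => ?_
    obtain ⟨k, hck, hk, hk0⟩ := (hc.and (htop.and (eventually_gt_atTop 0))).exists
    exact hck.trans (Fano.lct_le_one hk0 (Fano.sectionBasis n X k) (hk _))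
  · obtain ⟨k, hk, hs⟩ := (htop.and hstable).exists
    exact (hs (Fano.sectionBasis n X k)).ne (hk _)
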